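/- **Setting.** Let $L$ be a first-order language. A *positive formula* is built from atomic formulas with $\top,\bot,\wedge,\vee,\exists$; a *positive theory* $T$ is a set of sentences $\forall \bar x(\varphi(\bar x)\to\psi(\bar x))$ with $\varphi,\psi$ positive. A model $M$ of $T$ is *existentially closed (e.c.)* if every homomorphism from $M$ to a model of $T$ reflects positive formulas. It is *$\kappa$-saturated* if every set of positive formulas in fewer than $\kappa$ variables over fewer than $\kappa$ parameters from $M$ that is finitely satisfiable in $M$ is realised in $M$. A *type* over a set $B$ is a maximal finitely satisfiable set of positive formulas over $B$. A sequence $(a_i)_{i<\omega}$ of tuples is *$C$-indiscernible* if $a_{i_1}\dots a_{i_k}$ and $a_{j_1}\dots a_{j_k}$ satisfy the same positive formulas over $C$ whenever $k<\omega$, $i_1<\dots<i_k$ and $j_1<\dots<j_k$. Write $a\equiv^{\mathrm{Ls}}_C b$ if there are $a=a_0,a_1,\dots,a_n=b$ ($n<\omega$) such that $a_i$ and $a_{i+1}$ lie on a common $C$-indiscernible sequence for all $i<n$. The theory $T$ is *thick* if for each $n<\omega$ there is a set $\Theta((x_i)_{i<\omega})$ of positive formulas without parameters, each $x_i$ an $n$-tuple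 of variables, such that in every e.c. model of $T$ a sequence $(a_i)_{i<\omega}$ of $n$-tuples satisfies $\Theta$ if and only if it is ($\emptyset$-)indiscernible. Put $|T|=|L|+\aleph_0$ and $\lambda_T=\beth_{(2^{|T|})^+}$. Let $\mathfrak M$ be a monster model of $T$, that is, a $\kappa$-saturated e.c. model (homogeneity is not needed), and let $\mathfrak M^*\supseteq\mathfrak M$ be a bigger monster, that is, an e.c. model of $T$ extending $\mathfrak M$ that is $\kappa^*$-saturated for some $\kappa^*\ge\kappa$ with $\kappa^*>|\mathfrak M|$. For $C\subseteq B\subseteq\mathfrak M$, a type $q(x)$ over $B$ is *$C$-Ls-invariant* if for every realisation $\alpha$ of $q$ in $\mathfrak M^*$ and all (possibly infinite) tuples $b,b'$ in $B$ of the same length with $b\equiv^{\mathrm{Ls}}_C b'$ we have $\alpha b\equiv^{\mathrm{Ls}}_C\alpha b'$ (both relations computed in $\mathfrak M^*$). A *global* type is a type over $\mathfrak M$. **Proposition (Extending Ls-invariant types).** Let $T$ be a thick positive theory, and let $C\subseteq N\subseteq\mathfrak M$, where $N$ is an e.c. model of $T$, a substructure of $\mathfrak M$, with $|N|<\kappa$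 and $2^{|C|+\lambda_T}<\kappa$. Suppose that $N$ is $(2^{|C|+\lambda_T})^+$-saturated. Then every $C$-Ls-invariant type $p(x)$ over $N$ in fewer than $\kappa$ variables extends to a unique global $C$-Ls-invariant type $q(x)$. -/

import Mathlib

open scoped FirstOrder Cardinal

universe u v w x y

noncomputable section

namespace PosLogic

variable {L : FirstOrder.Language.{u, v}}

/-! ### Positive formulas, h-inductive theories, existentially closed models -/

/-- Positive (existential) formulas: built from atomic formulas with `⊤`, `⊥`, `∧`, `∨`, `∃`. -/
inductive IsPositive {α : Type x} : ∀ {n : ℕ}, L.BoundedFormula α n → Prop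
  | verum {n : ℕ} : IsPositive (⊤ : L.BoundedFormula α n)
  | falsum {n : ℕ} : IsPositive (⊥ : L.BoundedFormula α n)
  | atomic {n : ℕ} {φ : L.BoundedFormula α n} (h : φ.IsAtomic) : IsPositive φ
  | inf {n : ℕ} {φ ψ : L.BoundedFormula α n} (hφ : IsPositive φ) (hψ : IsPositive ψ) :
      IsPositive (φ ⊓ ψ)
  | sup {n : ℕ} {φ ψ : L.BoundedFormula α n} (hφ : IsPositive φ) (hψ : IsPositive ψ) :
      IsPositive (φ ⊔ ψ)
  | ex {n : ℕ} {φ : L.BoundedFormula α (n + 1)} (h : IsPositive φ) : IsPositive φ.ex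

/-- A positive (h-inductive) theory: a set of sentences `∀ x̄, φ(x̄) → ψ(x̄)` with `φ`, `ψ`
positive. -/
def IsHInductive (T : L.Theory) : Prop :=
  ∀ σ ∈ T, ∃ (n : ℕ) (φ ψ : L.BoundedFormula Empty n),
    IsPositive φ ∧ IsPositive ψ ∧ σ = (φ.imp ψ).alls

/-- An immersion: a homomorphism that reflects (as well as preserves) positive formulas. -/
def IsImmersion {M : Type w} {N : Type x} [L.Structure M] [L.Structure N] (f : M →[L] N) : Prop :=
  ∀ (n : ℕ) (φ : L.Formula (Fin n)), IsPositive φ → ∀ a : Fin n → M,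
    φ.Realize (f ∘ a) → φ.Realize a

/-- `M` is an existentially closed (e.c.) model of `T`: a model of `T` such that every homomorphism
from `M` into a model of `T` is an immersion. -/
def IsEC (T : L.Theory) (M : Type (max u v)) [L.Structure M] : Prop :=
  M ⊨ T ∧ ∀ (N : Type (max u v)) [L.Structure N], N ⊨ T → ∀ f : M →[L] N, IsImmersion f

/-! ### Partial types, types, saturation

A formula in the variables `(x_i)_{i ∈ ι}` with parameters in `B ⊆ M` is an element of
`L.Formula (ι ⊕ B)`. -/

section Types

variable {M : Type w} [L.Structure M]

/-- `M ⊨ φ(a)` where `φ` has parameters in `B`. -/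
def Holds {ι : Type x} {B : Set M} (φ : L.Formula (ι ⊕ B)) (a : ι → M) : Prop :=
  φ.Realize (Sum.elim a (fun b : B => (b : M)))

/-- `a` realises the set of formulas `p` over `B`. -/
def Realises {ι : Type x} {B : Set M} (a : ι → M) (p : Set (L.Formula (ι ⊕ B))) : Prop :=
  ∀ φ ∈ p, Holds φ a

/-- `p` is a partial type over `B`: a set of positive formulas over `B`, finitely satisfiable
in `M`. -/
def IsPartialType {ι : Type x} (B : Set M) (p : Set (L.Formula (ι ⊕ B))) : Prop :=
  (∀ φ ∈ p, IsPositive φ) ∧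
    ∀ F : Finset (L.Formula (ι ⊕ B)), (F : Set (L.Formula (ι ⊕ B))) ⊆ p →
      ∃ a : ι → M, ∀ φ ∈ F, Holds φ a

/-- `p` is a (maximal positive) type over `B`. -/
def IsType {ι : Type x} (B : Set M) (p : Set (L.Formula (ι ⊕ B))) : Prop :=
  Maximal (IsPartialType B) p

/-- The restriction `q|_A` of a type `q` over `B ⊇ A`: the positive formulas over `A` that belong
to `q` when they are read as formulas over `B`. -/
def restrict {ι : Type x} {A B : Set M} (h : A ⊆ B) (q : Set (L.Formula (ι ⊕ B))) :
    Set (L.Formula (ι ⊕ A)) :=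
  {φ | IsPositive φ ∧ φ.relabel (Sum.map id (Set.inclusion h)) ∈ q}

end Types

/-- `M` is `κ`-saturated: every partial type in fewer than `κ` variables over fewer than `κ`
parameters that is finitely satisfiable in `M` is realised in `M`. -/
def IsSaturated (L : FirstOrder.Language.{u, v}) (M : Type w) [L.Structure M] (κ : Cardinal.{w}) : Prop :=
  ∀ (A : Set M), #A < κ → ∀ (ι : Type w), #ι < κ →
    ∀ p : Set (L.Formula (ι ⊕ A)), IsPartialType A p → ∃ a : ι → M, Realises a p

/-! ### Indiscernible sequences, thickness, Lascar strong types -/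

section Lascar

variable {M : Type w} [L.Structure M]

variable (L) in
/-- The sequence of `J`-tuples `(s_i)_{i < ω}` is `C`-indiscernible. -/
def IsIndiscernible {J : Type x} (C : Set M) (s : ℕ → J → M) : Prop :=
  ∀ (k : ℕ) (f g : Fin k ↪o ℕ) (φ : L.Formula ((Fin k × J) ⊕ C)), IsPositive φ →
    (Holds φ (fun z => s (f z.1) z.2) ↔ Holds φ (fun z => s (g z.1) z.2))

variable (L) in
/-- `d_C(a, b) ≤ 1`: the tuples `a` and `b` are on a common `C`-indiscernible sequence. -/
def OnIndiscernible {J : Type x} (C : Set M) (a b : J → M) : Prop :=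
  ∃ s : ℕ → J → M, IsIndiscernible L C s ∧ ∃ i j : ℕ, s i = a ∧ s j = b

variable (L) in
/-- `a ≡ᴸˢ_C b`, that is, `d_C(a, b) ≤ n` for some `n < ω`: there are `a = a_0, …, a_n = b` such
that any two consecutive `a_i, a_{i+1}` are on a common `C`-indiscernible sequence. -/
def LsEquiv {J : Type x} (C : Set M) (a b : J → M) : Prop :=
  Relation.ReflTransGen (OnIndiscernible L C) a b

end Lascar

/-- `T` is thick: indiscernibility of sequences of (finite) tuples is type-definable, by a set of
positive formulas over `∅`. (For infinite tuples this follows, since a sequence of infinite tuples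
is indiscernible iff the corresponding sequences of finite subtuples are.) -/
def IsThick (T : L.Theory) : Prop :=
  ∀ n : ℕ, ∃ Θ : Set (L.Formula (ℕ × Fin n)), (∀ θ ∈ Θ, IsPositive θ) ∧
    ∀ (M : Type (max u v)) [L.Structure M], IsEC T M → ∀ s : ℕ → Fin n → M,
      (∀ θ ∈ Θ, θ.Realize (fun z : ℕ × Fin n => s z.1 z.2)) ↔ IsIndiscernible L (∅ : Set M) s

/-- The cardinal `λ_T = ℶ_{(2^{|T|})⁺}`, where `|T| = |L| + ℵ₀` is the number of formulas. -/
def lambdaT (L : FirstOrder.Language.{u, v}) : Cardinal.{max u v} :=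
  Cardinal.beth (Order.succ ((2 : Cardinal.{max u v}) ^ max ℵ₀ L.card)).ord

/-- A type `q` over `B` (in the variables `ι`) is `C`-Ls-invariant if for every realisation `α` of
`q` and all, possibly infinite, tuples `b, b'` in `B` with `b ≡ᴸˢ_C b'` one has
`αb ≡ᴸˢ_C αb'`. The ambient structure `M` is the one in which realisations and Lascar strong types
are computed. -/
def IsLsInvariant {M : Type w} [L.Structure M] {ι : Type x} (C : Set M) {B : Set M}
    (q : Set (L.Formula (ι ⊕ B))) : Prop :=
  ∀ α : ι → M, Realises α q →
    ∀ (J : Type w) (b b' : J → M), (∀ j, b j ∈ B) → (∀ j, b' j ∈ B) →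
      LsEquiv L C b b' → LsEquiv L C (Sum.elim α b) (Sum.elim α b')

end PosLogic

end

noncomputable section

namespace PosLogic

open FirstOrder FirstOrder.Language

/-! ### Closure properties of positive formulas -/

section Positive

variable {L : FirstOrder.Language.{u, v}} {α : Type x} {β : Type y}

/-! All computations take place in the big monster `U`, which is saturated beyond the cardinality of
the monster. Put μ = 2^(|C| + λ_T).

The heart of the proof is a small set D with C ⊆ D ⊆ N and |D| ≤ μ such that equality of types over
D implies Lascar equivalence over C (`IsThickMonster.exists_representatives`). Call two tuples near
over C if some tuple is at distance at most one from both. For each n take a maximal set of n-tuples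
from N that are pairwise not near. It has at most 2^(|C| + |T|) elements: in a larger one,
Erdős–Rado finds an infinite sequence whose pairs are all kept apart by the same formula, and
extracting an indiscernible sequence contradicts that formula. Saturation of N makes every n-tuple
of `U` near a member of this set. Let D consist of C and all these tuples. Two finite tuples of the
same type over D are near a common member, hence joined by two near steps. Thickness makes "joined
by two near steps" type-definable, so compactness carries it to infinite tuples.

By saturation of N, every tuple b of length at most μ then has a representative β in N with bD
Lascar equivalent to βD over C (`DeterminesLs.hasReps`). If α realises p, an invariant extension
must contain φ(x, b) exactly when φ(α, β) holds; this gives uniqueness. For existence the same rule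
serves as definition (`extendType`). Invariance of p makes it independent of the choice of β, and in
an e.c. model a failing positive formula is refuted by a positive one, which gives maximality.

For invariance of the extension, let α' realise it. Since bD and βD are Lascar equivalent, α'b and
α'β have the same type over D, so they are Lascar equivalent. This moves the question into N, where
invariance of p answers it. Longer tuples reduce to countable subtuples. -/

theorem IsPositive.boundedRelabel {n k : ℕ} {φ : L.BoundedFormula α k} (h : IsPositive φ)
    (g : α → β ⊕ Fin n) : IsPositive (φ.relabel g) := by
  induction h with
  | verum => exact .verum
  | falsum => exact .falsum
  | atomic h => exact .atomic (h.relabel g)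
  | inf _ _ ih₁ ih₂ => exact .inf ih₁ ih₂
  | sup _ _ ih₁ ih₂ => exact .sup ih₁ ih₂
  | ex _ ih => rw [BoundedFormula.relabel_ex]; exact .ex ih

theorem IsPositive.relabel {φ : L.Formula α} (h : IsPositive φ) (g : α → β) :
    IsPositive (Formula.relabel g φ) :=
  IsPositive.boundedRelabel h _

theorem IsPositive.restrictFreeVar [DecidableEq α] {n : ℕ} {φ : L.BoundedFormula α n}
    (h : IsPositive φ) : ∀ f : φ.freeVarFinset → β, IsPositive (φ.restrictFreeVar f) := by
  induction h with
  | verum => intro f; exact .verum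
  | falsum => intro f; exact .falsum
  | atomic h =>
    intro f
    cases h with
    | equal t₁ t₂ => exact .atomic (.equal _ _)
    | rel R ts => exact .atomic (.rel _ _)
  | inf _ _ ih₁ ih₂ => intro f; exact .inf (ih₁ _) (ih₂ _)
  | sup _ _ ih₁ ih₂ => intro f; exact .sup (ih₁ _) (ih₂ _)
  | ex _ ih => intro f; exact .ex (ih _)

theorem IsPositive.exs {n : ℕ} {φ : L.BoundedFormula α n} (h : IsPositive φ) :
    IsPositive φ.exs := by
  induction n with
  | zero => exact h
  | succ n ih => exact ih (.ex h)

theorem IsPositive.iExs [Finite β] {φ : L.Formula (α ⊕ β)} (h : IsPositive φ) :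
    IsPositive (φ.iExs β) :=
  IsPositive.exs (h.boundedRelabel _)

variable (L) in
/-- Bundled positive formulas. -/
def PosFormula (α : Type x) : Type (max u v x) :=
  {φ : L.Formula α // IsPositive φ}

namespace PosFormula

variable {M : Type w} [L.Structure M]

/-- Truth of a bundled positive formula. -/
def Realize (φ : PosFormula L α) (v : α → M) : Prop :=
  φ.1.Realize v

/-- Substitution of variables. -/
def relabel (φ : PosFormula L α) (g : α → β) : PosFormula L β :=
  ⟨φ.1.relabel g, φ.2.relabel g⟩

@[simp]
theorem realize_relabel (φ : PosFormula L α) (g : α → β) (v : β → M) :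
    (φ.relabel g).Realize v ↔ φ.Realize (v ∘ g) :=
  Formula.realize_relabel

theorem exists_and (φ ψ : PosFormula L α) : ∃ χ : PosFormula L α,
    ∀ (M : Type w) [L.Structure M] (v : α → M), χ.Realize v ↔ φ.Realize v ∧ ψ.Realize v :=
  ⟨⟨φ.1 ⊓ ψ.1, .inf φ.2 ψ.2⟩, fun _ _ _ => Formula.realize_inf⟩

theorem exists_forall_mem (F : Finset (PosFormula L α)) : ∃ χ : PosFormula L α,
    ∀ (M : Type w) [L.Structure M] (v : α → M), χ.Realize v ↔ ∀ φ ∈ F, φ.Realize v := by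
  classical
  induction F using Finset.induction_on with
  | empty => exact ⟨⟨⊤, .verum⟩, fun M _ v => by simp [Realize, Formula.Realize]⟩
  | insert φ F _ ih =>
    obtain ⟨χ, hχ⟩ := ih
    obtain ⟨θ, hθ⟩ := exists_and.{u, v, w, x} φ χ
    refine ⟨θ, fun M _ v => ?_⟩
    rw [hθ, hχ, Finset.forall_mem_insert]

theorem exists_finite_support (φ : PosFormula L α) :
    ∃ F : Finset α, ∃ χ : PosFormula L F,
      ∀ (M : Type w) [L.Structure M] (v : α → M), χ.Realize (fun i : F => v i) ↔ φ.Realize v := by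
  classical
  refine ⟨φ.1.freeVarFinset, ⟨φ.1.restrictFreeVar id, φ.2.restrictFreeVar _⟩, fun M _ v => ?_⟩
  exact BoundedFormula.realize_restrictFreeVar v (by simp)

/-- Only the finitely many quantified variables that occur in `φ` need a quantifier. The remaining
ones receive an arbitrary value, which is why the structure must be nonempty. -/
theorem exists_exists_sumElim (φ : PosFormula L (β ⊕ α)) :
    ∃ χ : PosFormula L α, ∀ (M : Type w) [L.Structure M] [Nonempty M] (v : α → M),
      χ.Realize v ↔ ∃ w : β → M, φ.Realize (Sum.elim w v) := by
  classical
  let F : Set β := {b | Sum.inl b ∈ φ.1.freeVarFinset}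
  have : Finite F := Set.Finite.to_subtype
    (Set.Finite.preimage Sum.inl_injective.injOn φ.1.freeVarFinset.finite_toSet)
  let f : φ.1.freeVarFinset → α ⊕ F := fun z => match z with
    | ⟨Sum.inl b, hb⟩ => Sum.inr ⟨b, hb⟩
    | ⟨Sum.inr a, _⟩ => Sum.inl a
  refine ⟨⟨Formula.iExs F (φ.1.restrictFreeVar f), (φ.2.restrictFreeVar f).iExs⟩, fun M _ _ v => ?_⟩
  have key : ∀ (i : F → M) (w : β → M), (∀ b : F, i b = w b) →
      (Formula.Realize (φ.1.restrictFreeVar f) (Sum.elim v i) ↔ φ.Realize (Sum.elim w v)) := by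
    intro i w hw
    refine BoundedFormula.realize_restrictFreeVar (Sum.elim w v) ?_
    rintro ⟨b | a, h⟩
    · exact hw _
    · rfl
  refine Formula.realize_iExs.trans ⟨?_, ?_⟩
  · rintro ⟨i, hi⟩
    refine ⟨fun b => if h : b ∈ F then i ⟨b, h⟩ else Classical.arbitrary M, ?_⟩
    exact (key i _ fun b => by simp [b.2]).1 hi
  · rintro ⟨w, hw⟩
    exact ⟨fun b => w b, (key _ w fun b => rfl).2 hw⟩

/-- The equality of two variables. -/
def eq (a b : α) : PosFormula L α :=
  ⟨Term.equal (Term.var a) (Term.var b), .atomic (.equal _ _)⟩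

@[simp]
theorem realize_eq (a b : α) (v : α → M) : (eq a b : PosFormula L α).Realize v ↔ v a = v b := by
  simp [eq, Realize]

theorem realize_hom {N : Type*} [L.Structure N] (φ : PosFormula L α) (f : M →[L] N) (v : α → M)
    (h : φ.Realize v) : φ.Realize (f ∘ v) := by
  have key : ∀ {n : ℕ} {φ : L.BoundedFormula α n} (_ : IsPositive φ) (xs : Fin n → M),
      φ.Realize v xs → φ.Realize (f ∘ v) (f ∘ xs) := by
    intro n φ hφ
    induction hφ with
    | verum => intro xs _; exact BoundedFormula.realize_top.2 trivial
    | falsum => intro xs h; exact (BoundedFormula.realize_bot.1 h).elim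
    | atomic h =>
      intro xs hx
      cases h with
      | equal t₁ t₂ =>
        simp only [BoundedFormula.realize_bdEqual, ← Sum.comp_elim, HomClass.realize_term] at hx ⊢
        rw [hx]
      | rel R ts =>
        rw [BoundedFormula.realize_rel] at hx ⊢
        simp only [← Sum.comp_elim, HomClass.realize_term]
        exact f.map_rel R _ hx
    | inf _ _ ih₁ ih₂ =>
      intro xs hx
      rw [BoundedFormula.realize_inf] at hx ⊢
      exact hx.imp (ih₁ _) (ih₂ _)
    | sup _ _ ih₁ ih₂ =>
      intro xs hx
      rw [BoundedFormula.realize_sup] at hx ⊢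
      exact hx.imp (ih₁ _) (ih₂ _)
    | ex _ ih =>
      intro xs hx
      rw [BoundedFormula.realize_ex] at hx ⊢
      obtain ⟨a, ha⟩ := hx
      refine ⟨f a, ?_⟩
      have := ih _ ha
      rwa [Fin.comp_snoc] at this
  have := key φ.2 default h
  rwa [Subsingleton.elim (f ∘ default) default] at this

theorem mk_le (L : FirstOrder.Language.{u, v}) (α : Type x) :
    #(PosFormula L α) ≤ max ℵ₀ (Cardinal.lift.{max u v} #α + Cardinal.lift.{x} L.card) := by
  refine le_trans ?_ (BoundedFormula.card_le (L := L) (α := α))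
  refine Cardinal.mk_le_of_injective (f := fun φ : PosFormula L α =>
    (⟨0, φ.1⟩ : Σ n, L.BoundedFormula α n)) fun φ ψ h => Subtype.ext ?_
  simpa using h

end PosFormula

end Positive

/-! ### Existentially closed models -/

section ExistentiallyClosed

variable {L : FirstOrder.Language.{u, v}} {T : L.Theory}

theorem IsImmersion.realize_of_comp {M N : Type w} [L.Structure M] [L.Structure N]
    {f : M →[L] N} (hf : IsImmersion f) {α : Type x} (φ : PosFormula L α) (a : α → M)
    (h : φ.Realize (f ∘ a)) : φ.Realize a := by
  obtain ⟨F, χ, hχ⟩ := φ.exists_finite_support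
  have e := F.equivFin
  have h₁ : (χ.relabel e).Realize (f ∘ fun i => a (e.symm i)) := by
    rw [PosFormula.realize_relabel]
    simpa [Function.comp_def] using (hχ N (f ∘ a)).2 h
  have h₂ := hf _ (χ.relabel e).1 (χ.relabel e).2 _ h₁
  have h₃ := (PosFormula.realize_relabel χ e _).1 h₂
  exact (hχ M a).1 (by simpa [Function.comp_def] using h₃)

variable {U : Type (max u v)} [L.Structure U]

/-- The maps `h i`, indexed by finite parts of the positive diagram of `U`, are glued along an
ultrafilter containing all tails. In the limit they preserve every positive formula, so they give a
homomorphism into an ultrapower, a model of `T` by Łoś. There `φ` holds at the image of `v`, and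
existential closedness pulls it back. -/
theorem IsEC.exists_of_forall_finset [Nonempty U] (hU : IsEC T U) {α : Type x}
    (φ : PosFormula L α) (v : α → U)
    (H : ∀ i : Finset {χ : PosFormula L U // χ.Realize id}, ∃ h : U → U,
      φ.Realize (h ∘ v) ∧ ∀ χ ∈ i, χ.1.Realize h) : φ.Realize v := by
  classical
  choose h hφ hχ using H
  let D : Ultrafilter (Finset {χ : PosFormula L U // χ.Realize id}) := Ultrafilter.of Filter.atTop
  have hD : ∀ χ : PosFormula L U, χ.Realize id → ∀ᶠ i in (D : Filter (Finset {χ : PosFormula L U // χ.Realize id})), χ.Realize (h i) := by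
    intro χ hid
    refine Ultrafilter.of_le Filter.atTop ?_
    filter_upwards [Filter.eventually_ge_atTop {⟨χ, hid⟩}] with i hi
    exact hχ i ⟨χ, hid⟩ (hi (Finset.mem_singleton_self _))
  let N := (D : Filter (Finset {χ : PosFormula L U // χ.Realize id})).Product (fun _ => U)
  let f : U → N := fun a => ((fun i => h i a : _ → U) : N)
  have hf : ∀ χ : PosFormula L U, χ.Realize id → χ.Realize f := fun χ hid =>
    (Ultraproduct.realize_formula_cast χ.1 fun a i => h i a).2 (hD χ hid)
  let F : U →[L] N :=
    { toFun := f
      map_fun' := by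
        intro n g x
        have := hf ⟨Term.equal (Term.func g fun i => Term.var (x i)) (Term.var (Structure.funMap g x)),
          .atomic (.equal _ _)⟩ (by simp [PosFormula.Realize])
        simp only [PosFormula.Realize, Formula.realize_equal, Term.realize] at this
        exact this.symm
      map_rel' := by
        intro n R x hx
        have := hf ⟨Relations.formula R fun i => Term.var (x i), .atomic (.rel _ _)⟩
          (by simpa [PosFormula.Realize, Formula.realize_rel] using hx)
        simpa [PosFormula.Realize, Formula.realize_rel, Function.comp_def] using this }
  have hN : N ⊨ T := by
    refine ⟨fun σ hσ => (Ultraproduct.sentence_realize σ).2 (Filter.Eventually.of_forall fun _ => ?_)⟩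
    exact hU.1.realize_of_mem σ hσ
  refine (hU.2 N hN F).realize_of_comp φ v ?_
  exact (Ultraproduct.realize_formula_cast φ.1 fun a i => h i (v a)).2
    (Filter.Eventually.of_forall hφ)

/-- Positive substitute for negation. If no `ψ` refuted `φ` at `v`, then every finite part of the
positive diagram of `U`, with the elements outside `v` quantified away, would be compatible with
`φ`, and the previous lemma would make `φ` true at `v`. -/
theorem IsEC.exists_contradicting [Nonempty U] (hU : IsEC T U) {α : Type x}
    (φ : PosFormula L α) (v : α → U) (hφ : ¬ φ.Realize v) :
    ∃ ψ : PosFormula L α, ψ.Realize v ∧ ∀ v' : α → U, φ.Realize v' → ¬ ψ.Realize v' := by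
  classical
  obtain ⟨F, φ', hφ'⟩ := φ.exists_finite_support
  suffices ∃ ψ : PosFormula L F, ψ.Realize (fun i : F => v i) ∧
      ∀ v' : F → U, φ'.Realize v' → ¬ ψ.Realize v' by
    obtain ⟨ψ, h₁, h₂⟩ := this
    refine ⟨ψ.relabel Subtype.val, (PosFormula.realize_relabel _ _ _).2 h₁, fun v' hv' hψ => ?_⟩
    exact h₂ _ ((hφ' U v').2 hv') ((PosFormula.realize_relabel _ _ _).1 hψ)
  by_contra H
  push Not at H
  refine hφ ((hφ' U v).1 (hU.exists_of_forall_finset φ' _ fun i => ?_))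
  obtain ⟨χ, hχ⟩ := PosFormula.exists_forall_mem
    ((i.image fun χ => χ.1.relabel (Sum.inl : U → U ⊕ F)) ∪
      Finset.univ.image fun l : F => PosFormula.eq (Sum.inl (v l)) (Sum.inr l))
  obtain ⟨ψ, hψ⟩ := χ.exists_exists_sumElim
  obtain ⟨v', hv', h'⟩ := H ψ ((hψ U _).2 ⟨id, (hχ U _).2 (by
    intro θ hθ
    rcases Finset.mem_union.1 hθ with hθ | hθ
    · obtain ⟨ξ, -, rfl⟩ := Finset.mem_image.1 hθ
      simpa using ξ.2
    · obtain ⟨l, -, rfl⟩ := Finset.mem_image.1 hθ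
      simp)⟩)
  obtain ⟨h, hh⟩ := (hψ U _).1 h'
  have hh := (hχ U _).1 hh
  have e : h ∘ (fun i : F => v i) = v' := by
    funext l
    simpa using hh _ (Finset.mem_union_right _ (Finset.mem_image_of_mem _ (Finset.mem_univ l)))
  refine ⟨h, e ▸ hv', fun ξ hξ => ?_⟩
  simpa using hh _ (Finset.mem_union_left _ (Finset.mem_image_of_mem _ hξ))

theorem IsEC.realize_iff_of_imp [Nonempty U] (hU : IsEC T U) {α : Type x} {v v' : α → U}
    (h : ∀ φ : PosFormula L α, φ.Realize v → φ.Realize v') (φ : PosFormula L α) :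
    φ.Realize v ↔ φ.Realize v' := by
  refine ⟨h φ, fun hφ => by_contra fun hn => ?_⟩
  obtain ⟨ψ, h₁, h₂⟩ := hU.exists_contradicting φ v hn
  exact h₂ v' hφ (h ψ h₁)

end ExistentiallyClosed

/-! ### Saturation for types with a tuple of parameters -/

section Saturation

variable {L : FirstOrder.Language.{u, v}} {T : L.Theory} {U : Type (max u v)} [L.Structure U]

/-- A set of positive formulas in the variables `α`, with parameters `c`, is finitely satisfiable
in the ambient structure. -/
def FinSat {α : Type x} {γ : Type y} (c : γ → U) (p : Set (PosFormula L (α ⊕ γ))) : Prop :=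
  ∀ F : Finset (PosFormula L (α ⊕ γ)), (F : Set _) ⊆ p →
    ∃ a : α → U, ∀ φ ∈ F, φ.Realize (Sum.elim a c)

variable (L) in
/-- Types over fewer than `κ` parameters from `A` in fewer than `κ` variables that are finitely
satisfiable in the ambient structure are realised in `A`. -/
def SatIn (A : Set U) (κ : Cardinal.{max u v}) : Prop :=
  ∀ (α : Type (max u v)), #α < κ → ∀ (γ : Type (max u v)) (c : γ → U), (∀ i, c i ∈ A) →
    #(Set.range c) < κ → ∀ p : Set (PosFormula L (α ⊕ γ)), FinSat c p →
      ∃ a : α → U, (∀ i, a i ∈ A) ∧ ∀ φ ∈ p, φ.Realize (Sum.elim a c)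

/-- The inclusion of an e.c. model is an immersion, so a type over parameters in `P` that is
finitely satisfiable in `U` is already finitely satisfiable in `P`. -/
theorem IsSaturated.satIn_of_isEC [Nonempty U] {P : L.Substructure U} {κ : Cardinal.{max u v}}
    (hU : U ⊨ T) (hP : IsEC T P) (h : IsSaturated L P κ) : SatIn L (P : Set U) κ := by
  classical
  intro α hα γ c hc hcard p hp
  have himm : IsImmersion P.subtype.toHom := hP.2 U hU _
  -- The sentence ∃x ⊤ holds in `U` and is reflected by the immersion.
  have : Nonempty P := by
    have := himm 0 (⊤ : L.BoundedFormula (Fin 0) 1).ex (.ex .verum) Fin.elim0 (by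
      simp only [Formula.Realize, BoundedFormula.realize_ex, BoundedFormula.realize_top,
        exists_const])
    simp only [Formula.Realize, BoundedFormula.realize_ex, BoundedFormula.realize_top] at this
    exact ⟨this.choose⟩
  let c' : γ → P := fun i => ⟨c i, hc i⟩
  let A : Set P := Set.range c'
  have hA : #A < κ := by
    refine lt_of_le_of_lt ?_ hcard
    refine Cardinal.mk_le_of_injective (f := fun x : A => (⟨x.1.1, ?_⟩ : Set.range c)) ?_
    · obtain ⟨i, hi⟩ := x.2
      exact ⟨i, by rw [← hi]⟩
    · intro x y hxy
      exact Subtype.ext (Subtype.ext (congrArg (fun z : Set.range c => (z : U)) hxy))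
  let g : α ⊕ γ → α ⊕ A := Sum.map id fun i => ⟨c' i, i, rfl⟩
  have hg : ∀ (φ : PosFormula L (α ⊕ γ)) (a : α → P),
      Holds (φ.relabel g).1 a ↔ φ.Realize (Sum.elim a c') := by
    intro φ a
    refine (PosFormula.realize_relabel φ g _).trans ?_
    rw [iff_iff_eq]
    congr 1
    funext i
    cases i <;> rfl
  have hPU : ∀ (φ : PosFormula L (α ⊕ γ)) (a : α → P),
      φ.Realize (Sum.elim a c') → φ.Realize (Sum.elim (fun i => (a i : U)) c) := by
    intro φ a hφ
    have := φ.realize_hom P.subtype.toHom _ hφ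
    rw [Sum.comp_elim] at this
    exact this
  obtain ⟨a, ha⟩ := h A hA α hα {ψ | ∃ φ ∈ p, (φ.relabel g).1 = ψ} ⟨by
      rintro _ ⟨φ, -, rfl⟩; exact (φ.relabel g).2, by
      intro F hF
      have : ∀ ψ : F, ∃ φ ∈ p, (φ.relabel g).1 = ψ.1 := fun ψ => hF ψ.2
      choose k hk hk' using this
      obtain ⟨a, ha⟩ := hp (Finset.univ.image k) (by
        intro φ hφ
        obtain ⟨ψ, -, rfl⟩ := Finset.mem_image.1 (Finset.mem_coe.1 hφ)
        exact hk ψ)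
      obtain ⟨χ, hχ⟩ := PosFormula.exists_forall_mem (Finset.univ.image k)
      obtain ⟨θ, hθ⟩ := χ.exists_exists_sumElim
      have h₁ : θ.Realize (P.subtype.toHom ∘ c') := (hθ U _).2 ⟨a, (hχ U _).2 ha⟩
      obtain ⟨a', ha'⟩ := (hθ P _).1 (himm.realize_of_comp θ c' h₁)
      refine ⟨a', fun ψ hψ => ?_⟩
      rw [show ψ = _ from (hk' ⟨ψ, hψ⟩).symm, hg]
      exact (hχ P _).1 ha' _ (Finset.mem_image_of_mem _ (Finset.mem_univ _))⟩
  refine ⟨fun i => a i, fun i => (a i).2, fun φ hφ => hPU φ a ?_⟩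
  exact (hg φ a).1 (ha _ ⟨φ, hφ, rfl⟩)

theorem IsSaturated.satIn_univ {κ : Cardinal.{max u v}} (h : IsSaturated L U κ) :
    SatIn L (Set.univ : Set U) κ := by
  classical
  intro α hα γ c hc hcard p hp
  let g : α ⊕ γ → α ⊕ Set.range c := Sum.map id fun i => ⟨c i, i, rfl⟩
  have hg : ∀ (φ : PosFormula L (α ⊕ γ)) (a : α → U),
      Holds (φ.relabel g).1 a ↔ φ.Realize (Sum.elim a c) := by
    intro φ a
    refine (PosFormula.realize_relabel φ g _).trans ?_
    rw [iff_iff_eq]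
    congr 1
    funext i
    cases i <;> rfl
  obtain ⟨a, ha⟩ := h (Set.range c) hcard α hα {ψ | ∃ φ ∈ p, (φ.relabel g).1 = ψ} ⟨by
      rintro _ ⟨φ, -, rfl⟩; exact (φ.relabel g).2, by
      intro F hF
      have : ∀ ψ : F, ∃ φ ∈ p, (φ.relabel g).1 = ψ.1 := fun ψ => hF ψ.2
      choose k hk hk' using this
      obtain ⟨a, ha⟩ := hp (Finset.univ.image k) (by
        intro φ hφ
        obtain ⟨ψ, -, rfl⟩ := Finset.mem_image.1 (Finset.mem_coe.1 hφ)
        exact hk ψ)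
      refine ⟨a, fun ψ hψ => ?_⟩
      rw [show ψ = _ from (hk' ⟨ψ, hψ⟩).symm, hg]
      exact ha _ (Finset.mem_image_of_mem _ (Finset.mem_univ _))⟩
  exact ⟨a, fun _ => trivial, fun φ hφ => (hg φ a).1 (ha _ ⟨φ, hφ, rfl⟩)⟩

end Saturation

/-! ### The Erdős–Rado theorem, for colourings of tuples -/

section ErdosRado

open Cardinal

/-- The iterated exponential `exp_k(c)`. -/
def iteratedExp (c : Cardinal.{w}) : ℕ → Cardinal.{w}
  | 0 => c
  | k + 1 => 2 ^ iteratedExp c k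

theorem le_iteratedExp (c : Cardinal.{w}) (k : ℕ) : c ≤ iteratedExp c k := by
  induction k with
  | zero => exact le_rfl
  | succ k ih => exact ih.trans (cantor _).le

theorem exists_strictMono_comp {I : Type x} [LinearOrder I] [WellFoundedLT I] {g : ℕ → I}
    (hg : Function.Injective g) : ∃ r : ℕ → ℕ, StrictMono r ∧ StrictMono (g ∘ r) := by
  obtain ⟨r, hr⟩ := exists_increasing_or_nonincreasing_subseq (· < ·) g
  refine ⟨r, r.strictMono, ?_⟩
  rcases hr with hr | hr
  · intro m n hmn
    exact hr m n hmn
  · exfalso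
    have : ∀ m n, m < n → g (r n) < g (r m) := fun m n hmn =>
      lt_of_le_of_ne (not_lt.1 (hr m n hmn)) fun h => hmn.ne' (r.injective (hg h))
    exact (RelEmbedding.natGT (r := ((· < ·) : I → I → Prop)) (g ∘ r)
      fun n => this n (n + 1) n.lt_succ_self).not_wellFounded wellFounded_lt

/-- An end-homogeneous sequence: the colour of a tuple does not depend on its last entry. -/
theorem exists_endHomogeneous {X K : Type w} {θ : Cardinal.{w}} (hθ : ℵ₀ ≤ θ) (hX : 2 ^ θ < #X)
    (hK : #K ≤ θ) {k : ℕ} (F : (Fin (k + 1) → X) → K) :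
    ∃ (b : (Order.succ θ).ord.ToType → X) (x : X), Function.Injective b ∧
      ∀ (t : Fin k → (Order.succ θ).ord.ToType) (i : (Order.succ θ).ord.ToType), (∀ l, t l < i) →
        F (Fin.snoc (b ∘ t) (b i)) = F (Fin.snoc (b ∘ t) x) := by
  classical
  let I := (Order.succ θ).ord.ToType
  have hI : ∀ i : I, #(Set.Iio i) ≤ θ := fun i => Order.lt_succ_iff.1
    ((mk_Iio_lt i (by simp [I])).trans_eq (by simp [I]))
  let : LinearOrder X := IsWellOrder.linearOrder WellOrderingRel
  have wf : WellFounded ((· < ·) : X → X → Prop) := (inferInstance : IsWellOrder X WellOrderingRel).wf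
  -- Candidates for the `i`-th term of the sequence grown for `x`: elements that equal the same
  -- earlier terms as `x` does and give the same colours as `x` in last position. The least
  -- candidate is chosen, so the sequence depends on `x` only through this information.
  let S : ∀ (x : X) (i : I), (∀ j, j < i → X) → Set X := fun x i f =>
    {y | (∀ j (h : j < i), (y = f j h ↔ x = f j h)) ∧
      ∀ (t : Fin k → I) (h : ∀ l, t l < i),
        F (Fin.snoc (fun l => f (t l) (h l)) y) = F (Fin.snoc (fun l => f (t l) (h l)) x)}
  have hS : ∀ x i f, (S x i f).Nonempty := fun x i f => ⟨x, fun _ _ => Iff.rfl, fun _ _ => rfl⟩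
  let b : X → I → X := fun x => (wellFounded_lt (α := I)).fix fun i f => wf.min (S x i f) (hS x i f)
  have hb : ∀ x i, b x i = wf.min (S x i fun j _ => b x j) (hS _ _ _) := fun x i =>
    WellFounded.fix_eq _ _ _
  have hbS : ∀ x i, b x i ∈ S x i fun j _ => b x j := fun x i => by
    rw [hb]; exact wf.min_mem _ _
  -- An `x` that never appears in its own sequence makes the sequence injective and end-homogeneous.
  -- The rest is a count showing that such an `x` exists.
  suffices ∃ x, ∀ i, x ≠ b x i by
    obtain ⟨x, hx⟩ := this
    refine ⟨b x, x, ?_, fun t i h => (hbS x i).2 t h⟩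
    have : ∀ i j, j < i → b x i ≠ b x j := fun i j h e => hx j (((hbS x i).1 j h).1 e)
    intro i j e
    rcases lt_trichotomy i j with h | h | h
    · exact (this j i h e.symm).elim
    · exact h
    · exact (this i j h e).elim
  by_contra H
  push Not at H
  have hmin : ∀ x, ∃ i, x = b x i ∧ ∀ j < i, x ≠ b x j := fun x =>
    ⟨(wellFounded_lt (α := I)).min {i | x = b x i} (H x), (wellFounded_lt (α := I)).min_mem _ (H x),
      fun j hj e => WellFounded.not_lt_min wellFounded_lt {i | x = b x i} e hj⟩
  choose i hi hi' using hmin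
  -- If every `x` appears in its own sequence, the first place of appearance together with the
  -- colours below it determines the sequence up to that place, hence `x`. There are at most θ⁺ ·
  -- 2^θ = 2^θ codes, too few for `X`.
  let code : X → Σ i : I, ((Fin k → Set.Iio i) → K) := fun x =>
    ⟨i x, fun t => F (Fin.snoc (fun l => b x (t l)) x)⟩
  have hcode : Function.Injective code := by
    intro x x' hxx
    obtain ⟨e₁, e₂⟩ := Sigma.mk.inj_iff.1 hxx
    have e₂ : ∀ t : Fin k → I, (∀ l, t l < i x) →
        F (Fin.snoc (fun l => b x (t l)) x) = F (Fin.snoc (fun l => b x' (t l)) x') := by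
      intro t ht
      have ht' : ∀ l, t l < i x' := fun l => e₁ ▸ ht l
      have : ∀ (j : I) (e : i x = j) (g : (Fin k → Set.Iio (i x)) → K)
          (g' : (Fin k → Set.Iio j) → K), HEq g g' →
          ∀ (h : ∀ l, t l < i x) (h' : ∀ l, t l < j),
            g (fun l => ⟨t l, h l⟩) = g' (fun l => ⟨t l, h' l⟩) := by
        rintro j rfl g g' h _ _
        rw [eq_of_heq h]
      exact this _ e₁ _ _ e₂ ht ht'
    have hbb : ∀ j, j ≤ i x → b x j = b x' j := by
      intro j
      induction j using (wellFounded_lt (α := I)).induction with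
      | _ j ih =>
        intro hj
        have : (S x j fun j _ => b x j) = S x' j fun j _ => b x' j := by
          ext y
          refine and_congr ?_ ?_
          · refine forall_congr' fun l => forall_congr' fun hl => ?_
            beta_reduce
            rw [← ih l hl (hl.le.trans hj)]
            have h₁ : x ≠ b x l := hi' x l (hl.trans_le hj)
            have h₂ : x' ≠ b x l := by
              rw [ih l hl (hl.le.trans hj)]
              exact hi' x' l (by rw [← e₁]; exact hl.trans_le hj)
            simp [h₁, h₂]
          · refine forall_congr' fun t => forall_congr' fun ht => ?_
            have e : (fun l => b x (t l)) = fun l => b x' (t l) :=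
              funext fun l => ih _ (ht l) ((ht l).le.trans hj)
            have := e₂ t fun l => (ht l).trans_le hj
            simp only [← e] at this ⊢
            rw [this]
        rw [hb x, hb x']
        simp only [this]
    rw [hi x, hbb _ le_rfl, e₁, ← hi x']
  refine absurd (mk_le_of_injective hcode) (not_le.2 (lt_of_le_of_lt ?_ hX))
  have h2θ : ℵ₀ ≤ (2 : Cardinal.{w}) ^ θ := hθ.trans (cantor θ).le
  have hone : ∀ i : I, #((Fin k → Set.Iio i) → K) ≤ 2 ^ θ := by
    intro i
    have h₁ : #(Fin k → Set.Iio i) ≤ θ := by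
      have : #(Fin k → Set.Iio i) = #(Set.Iio i) ^ k := by simp
      rw [this]
      exact (power_le_power_right (hI i)).trans (power_nat_le hθ)
    rw [← power_def, ← power_self_eq hθ]
    exact (power_le_power_right hK).trans
      (power_le_power_left (pos_iff_ne_zero.1 (aleph0_pos.trans_le hθ)) h₁)
  rw [mk_sigma]
  calc Cardinal.sum (fun i : I => #((Fin k → Set.Iio i) → K)) ≤ Cardinal.sum fun _ : I => 2 ^ θ :=
        sum_le_sum _ _ hone
    _ = #I * 2 ^ θ := by simp
    _ ≤ 2 ^ θ * 2 ^ θ := by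
        refine mul_le_mul_left ?_ _
        rw [mk_ord_toType]
        exact Order.succ_le_of_lt (cantor θ)
    _ = 2 ^ θ := mul_eq_self h2θ

/-- Induction on `k`, starting from the pigeonhole principle. An end-homogeneous sequence of length
θ⁺ removes the dependence on the last entry, so the colouring descends to tuples shorter by one;
thinning to an increasing subsequence keeps the last entry above the others. -/
theorem exists_homogeneous {c : Cardinal.{w}} (hc : ℵ₀ ≤ c) {K : Type w} (hK : #K ≤ c) (k : ℕ) :
    ∀ {X : Type w}, iteratedExp c k < #X → ∀ F : (Fin (k + 1) → X) → K,
      ∃ g : ℕ → X, Function.Injective g ∧ ∃ a : K, ∀ f : Fin (k + 1) → ℕ, StrictMono f →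
        F (g ∘ f) = a := by
  induction k with
  | zero =>
    intro X hX F
    have : Infinite X := infinite_iff.2 (hc.trans hX.le)
    obtain ⟨a, ha⟩ := exists_infinite_fiber (fun x => F fun _ => x) (hK.trans_lt hX)
    let g : ℕ ↪ (fun x => F fun _ => x) ⁻¹' {a} := Infinite.natEmbedding _
    refine ⟨fun n => g n, Subtype.val_injective.comp g.injective, a, fun f _ => ?_⟩
    refine Eq.trans (congrArg F (funext fun l => ?_)) (g (f 0)).2
    rw [Fin.fin_one_eq_zero l]
    rfl
  | succ k ih =>
    intro X hX F
    have hθ : ℵ₀ ≤ iteratedExp c k := hc.trans (le_iteratedExp c k)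
    obtain ⟨b, x, hb, hend⟩ := exists_endHomogeneous hθ hX (hK.trans (le_iteratedExp c k)) F
    obtain ⟨g, hg, a, ha⟩ := ih (X := (Order.succ (iteratedExp c k)).ord.ToType)
      (by rw [mk_ord_toType]; exact Order.lt_succ _) fun t => F (Fin.snoc (b ∘ t) x)
    obtain ⟨r, hr, hgr⟩ := exists_strictMono_comp hg
    refine ⟨b ∘ g ∘ r, hb.comp (hg.comp hr.injective), a, fun f hf => ?_⟩
    have h₁ : (b ∘ g ∘ r) ∘ f =
        Fin.snoc (b ∘ fun l => g (r (f l.castSucc))) (b (g (r (f (Fin.last _))))) := by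
      funext l
      refine Fin.lastCases ?_ (fun l => ?_) l <;> simp
    rw [h₁, hend (fun l => g (r (f l.castSucc))) (g (r (f (Fin.last _)))) fun l =>
      hgr (hf (Fin.castSucc_lt_last l))]
    exact ha (fun l => r (f l.castSucc)) fun l l' h => hr (hf (by simpa using h))

end ErdosRado

/-! ### Indiscernible sequences -/

section Indiscernible

variable {L : FirstOrder.Language.{u, v}} {U : Type (max u v)} [L.Structure U]

variable (L) in
/-- Indiscernibility over the empty set, in terms of formulas without parameters. -/
def Indisc {J : Type x} (s : ℕ → J → U) : Prop :=
  ∀ (k : ℕ) (f g : Fin k ↪o ℕ) (φ : PosFormula L (Fin k × J)),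
    φ.Realize (fun z => s (f z.1) z.2) ↔ φ.Realize (fun z => s (g z.1) z.2)

theorem isIndiscernible_empty_iff {J : Type x} {s : ℕ → J → U} :
    IsIndiscernible L (∅ : Set U) s ↔ Indisc L s := by
  constructor
  · intro h k f g φ
    have key : ∀ a : Fin k × J → U,
        Holds (B := (∅ : Set U)) (φ.relabel Sum.inl).1 a ↔ φ.Realize a := fun a =>
      (PosFormula.realize_relabel φ _ _).trans (by rw [Sum.elim_comp_inl])
    rw [← key, ← key]
    exact h k f g _ (φ.relabel Sum.inl).2
  · intro h k f g φ hφ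
    let r : (Fin k × J) ⊕ (∅ : Set U) → Fin k × J := Sum.elim id fun c => c.2.elim
    have key : ∀ a : Fin k × J → U,
        Holds φ a ↔ (PosFormula.relabel (L := L) ⟨φ, hφ⟩ r).Realize a := by
      intro a
      refine Iff.trans ?_ (PosFormula.realize_relabel (L := L) ⟨φ, hφ⟩ r a).symm
      rw [iff_iff_eq]
      refine congrArg φ.Realize (funext fun z => ?_)
      rcases z with z | ⟨z, hz⟩
      · rfl
      · exact hz.elim
    rw [key, key]
    exact h k f g _

/-- Parameters become constant coordinates, so that thickness, which speaks of indiscernibility over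
the empty set only, applies over `C`. -/
theorem IsIndiscernible.indisc_sumElim {J : Type x} {C : Set U} {s : ℕ → J → U}
    (h : IsIndiscernible L C s) : Indisc L fun i => Sum.elim (s i) ((↑) : C → U) := by
  intro k f g φ
  let r : Fin k × (J ⊕ C) → (Fin k × J) ⊕ C := fun z =>
    Sum.elim (fun j => Sum.inl (z.1, j)) Sum.inr z.2
  have key : ∀ f : Fin k ↪o ℕ, Holds (φ.relabel r).1 (fun z : Fin k × J => s (f z.1) z.2) ↔
      φ.Realize (fun z => Sum.elim (s (f z.1)) ((↑) : C → U) z.2) := by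
    intro f
    refine (PosFormula.realize_relabel φ r _).trans ?_
    rw [iff_iff_eq]
    refine congrArg φ.Realize (funext fun z => ?_)
    rcases z with ⟨i, j | c⟩ <;> rfl
  rw [← key, ← key]
  exact h k f g _ (φ.relabel r).2

theorem Indisc.isIndiscernible {J : Type x} {C : Set U} {s : ℕ → J → U}
    (h : Indisc L fun i => Sum.elim (s i) ((↑) : C → U)) : IsIndiscernible L C s := by
  intro k f g φ hφ
  -- A parameter is read off from term 0 of the appended sequence, so at least one term is needed;
  -- with no terms there is nothing to compare.
  cases k with
  | zero => rw [show f = g from RelEmbedding.ext fun i => i.elim0]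
  | succ k =>
    let r : (Fin (k + 1) × J) ⊕ C → Fin (k + 1) × (J ⊕ C) :=
      Sum.elim (fun z => (z.1, Sum.inl z.2)) fun c => (0, Sum.inr c)
    have key : ∀ f : Fin (k + 1) ↪o ℕ, Holds φ (fun z : Fin (k + 1) × J => s (f z.1) z.2) ↔
        (PosFormula.relabel (L := L) ⟨φ, hφ⟩ r).Realize
          (fun z => Sum.elim (s (f z.1)) ((↑) : C → U) z.2) := by
      intro f
      refine Iff.trans ?_ (PosFormula.realize_relabel (L := L) ⟨φ, hφ⟩ r _).symm
      rw [iff_iff_eq]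
      refine congrArg φ.Realize (funext fun z => ?_)
      rcases z with ⟨i, j⟩ | c <;> rfl
    rw [key, key]
    exact h _ f g _

theorem Indisc.comp {J : Type x} {J' : Type y} {s : ℕ → J → U} (h : Indisc L s) (e : J' → J) :
    Indisc L fun i => s i ∘ e := by
  intro k f g φ
  have := h k f g (φ.relabel (Prod.map id e))
  rw [PosFormula.realize_relabel, PosFormula.realize_relabel] at this
  exact this

/-- A formula involves finitely many coordinates. This lets the conditions that thickness supplies
for finite tuples define indiscernibility of sequences of infinite tuples. -/
theorem Indisc.of_finite {J : Type x} {s : ℕ → J → U}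
    (h : ∀ (m : ℕ) (e : Fin m → J), Indisc L fun i => s i ∘ e) : Indisc L s := by
  classical
  intro k f g φ
  obtain ⟨F, χ, hχ⟩ := φ.exists_finite_support
  let J₀ := F.image Prod.snd
  let e := J₀.equivFin
  let r : F → Fin k × Fin J₀.card := fun z =>
    (z.1.1, e ⟨z.1.2, Finset.mem_image_of_mem _ z.2⟩)
  have := h _ (fun l => ((e.symm l : J₀) : J)) k f g (χ.relabel r)
  rw [PosFormula.realize_relabel, PosFormula.realize_relabel] at this
  simp only [Function.comp_def, r, Equiv.symm_apply_apply] at this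
  exact ((hχ U _).symm.trans this).trans (hχ U _)

theorem Indisc.subseq {J : Type x} {s : ℕ → J → U} (h : Indisc L s) (r : ℕ ↪o ℕ) :
    Indisc L fun i => s (r i) := fun k f g φ => h k (f.trans r) (g.trans r) φ

theorem indisc_const {J : Type x} (a : J → U) : Indisc L fun _ => a := fun _ _ _ _ => Iff.rfl

end Indiscernible

/-! ### Relations presented by countably many witnesses and local conditions -/

section Presentation

variable {L : FirstOrder.Language.{u, v}} {U : Type (max u v)} [L.Structure U]

variable (L) in
/-- A family of binary relations between tuples, given by existentially quantifying a countable
family of tuples subject to positive conditions on finite subtuples. -/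
structure Presentation where
  /-- The index set of the tuples. -/
  K : Type
  /-- Countably many tuples. -/
  countable : Countable K
  /-- The index of the first tuple that is related. -/
  fst : K
  /-- The index of the second tuple that is related. -/
  snd : K
  /-- The conditions on subtuples of length `m`. -/
  cond : ∀ m : ℕ, Set (PosFormula L (K × Fin m))

namespace Presentation

variable {J : Type x}

/-- `w` satisfies the conditions of the presentation. -/
def Sat (π : Presentation L) (w : π.K × J → U) : Prop :=
  ∀ (m : ℕ) (e : Fin m → J), ∀ φ ∈ π.cond m, φ.Realize (fun z => w (z.1, e z.2))

/-- The coordinates in `Q` are the same in all tuples of the family. -/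
def ConstOn {K : Type} {M : Type w} (Q : Set J) (w : K × J → M) : Prop :=
  ∀ j ∈ Q, ∀ k k', w (k, j) = w (k', j)

/-- The relation on `J`-tuples given by a presentation, where the coordinates in `Q` serve as
parameters. -/
def Rel (π : Presentation L) (Q : Set J) (a b : J → U) : Prop :=
  ∃ w : π.K × J → U, (∀ j, w (π.fst, j) = a j) ∧ (∀ j, w (π.snd, j) = b j) ∧ π.Sat w ∧ ConstOn Q w

theorem Sat.comp {π : Presentation L} {w : π.K × J → U} (h : π.Sat w) {J' : Type y} (e : J' → J) :
    π.Sat fun z : π.K × J' => w (z.1, e z.2) := fun m e' φ hφ => h m (e ∘ e') φ hφ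

theorem Rel.comp {π : Presentation L} {Q : Set J} {a b : J → U} (h : π.Rel Q a b) {J' : Type y}
    (e : J' → J) : π.Rel (e ⁻¹' Q) (a ∘ e) (b ∘ e) := by
  obtain ⟨w, h₀, h₁, hw, hQ⟩ := h
  exact ⟨_, fun j => h₀ _, fun j => h₁ _, hw.comp e, fun j hj => hQ (e j) hj⟩

/-- The substitution of variables induced by a map of indices. -/
def subst (K : Type) {J : Type x} {J' : Type y} (e : J' → J) :
    (K × J') ⊕ (J' ⊕ J') → (K × J) ⊕ (J ⊕ J) :=
  Sum.map (Prod.map id e) (Sum.map e e)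

theorem sumElim_comp_subst {K : Type} {J' : Type y} (e : J' → J) {M : Type w}
    (w : K × J → M) (a b : J → M) :
    Sum.elim w (Sum.elim a b) ∘ subst K e =
      Sum.elim (fun z => w (z.1, e z.2)) (Sum.elim (a ∘ e) (b ∘ e)) := by
  funext z
  rcases z with z | z | z <;> rfl

variable (U) in
/-- `φ` holds of all tuples with the relation and their witnesses. -/
def IsConsequence (π : Presentation L) {m : ℕ} (Q : Set (Fin m))
    (φ : PosFormula L ((π.K × Fin m) ⊕ (Fin m ⊕ Fin m))) : Prop :=
  ∀ (w : π.K × Fin m → U), π.Sat w → ConstOn Q w → φ.Realize (Sum.elim w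
    (Sum.elim (fun l => w (π.fst, l)) fun l => w (π.snd, l)))

/-- Compactness for presented relations: failure of the relation is always visible on a finite
subtuple and through one positive formula. The relation is therefore type-definable, which the next
two lemmas exploit. -/
theorem exists_separating {T : L.Theory} [Nonempty U] (hU : IsEC T U) {κ : Cardinal.{max u v}}
    (hκ : ℵ₀ < κ) (hsat : SatIn L (Set.univ : Set U) κ) (π : Presentation L)
    {J : Type (max u v)} (hJ : #J < κ) (Q : Set J) (a b : J → U) (h : ¬ π.Rel Q a b) :
    ∃ (m : ℕ) (e : Fin m → J) (ψ : PosFormula L (Fin m ⊕ Fin m)),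
      ψ.Realize (Sum.elim (a ∘ e) (b ∘ e)) ∧
        ∀ a' b' : Fin m → U, ψ.Realize (Sum.elim a' b') → ¬ π.Rel (e ⁻¹' Q) a' b' := by
  classical
  by_contra H
  push Not at H
  have := π.countable
  -- All positive consequences of the relation, with witnesses among the variables. Taking
  -- consequences covers at once the conditions, the equations with `a` and `b`, and constancy on
  -- `Q`. If a finite part had no witnesses at `(a, b)`, a formula refuting it would exclude the
  -- relation on a finite subtuple, against `H`.
  let p : Set (PosFormula L ((π.K × J) ⊕ (J ⊕ J))) :=
    {φ | ∃ (m : ℕ) (e : Fin m → J) (φ₀ : PosFormula L ((π.K × Fin m) ⊕ (Fin m ⊕ Fin m))),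
      π.IsConsequence U (e ⁻¹' Q) φ₀ ∧ φ₀.relabel (subst π.K e) = φ}
  have hp : FinSat (Sum.elim a b) p := by
    intro F hF
    have hF' : ∀ φ : F, φ.1 ∈ p := fun φ => hF φ.2
    choose m e φ₀ hcons hφ₀ using hF'
    let J₀ : Finset J := Finset.univ.biUnion fun φ : F => Finset.univ.image (e φ)
    have hJ₀ : ∀ φ l, e φ l ∈ J₀ := fun φ l =>
      Finset.mem_biUnion.2 ⟨φ, Finset.mem_univ _, Finset.mem_image_of_mem _ (Finset.mem_univ _)⟩
    let E := J₀.equivFin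
    let e₀ : Fin J₀.card → J := fun l => (E.symm l : J₀)
    let t : ∀ φ, Fin (m φ) → Fin J₀.card := fun φ l => E ⟨e φ l, hJ₀ φ l⟩
    have ht : ∀ φ, e₀ ∘ t φ = e φ := fun φ => by funext l; simp [e₀, t]
    obtain ⟨η, hη⟩ := PosFormula.exists_forall_mem
      (Finset.univ.image fun φ : F => (φ₀ φ).relabel (subst π.K (t φ)))
    obtain ⟨η', hη'⟩ := η.exists_exists_sumElim
    have hholds : η'.Realize (Sum.elim (a ∘ e₀) (b ∘ e₀)) := by
      by_contra hn
      obtain ⟨ψ, hψ, hψη⟩ := hU.exists_contradicting η' _ hn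
      obtain ⟨a', b', hψ', w, ha, hb, hw, hwQ⟩ := H _ e₀ ψ hψ
      refine hψη _ ((hη' U _).2 ⟨w, (hη U _).2 fun φ hφ => ?_⟩) hψ'
      obtain ⟨φ, -, rfl⟩ := Finset.mem_image.1 hφ
      rw [PosFormula.realize_relabel, sumElim_comp_subst]
      have := hcons φ _ (hw.comp (t φ)) fun l hl => hwQ _ (by
        rwa [Set.mem_preimage, ← ht φ] at hl)
      simpa only [ha, hb, Function.comp_def] using this
    obtain ⟨w₀, hw₀⟩ := (hη' U _).1 hholds
    let w : π.K × J → U := fun z =>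
      if hz : z.2 ∈ J₀ then w₀ (z.1, E ⟨z.2, hz⟩) else Classical.arbitrary U
    refine ⟨w, fun φ hφ => ?_⟩
    have h₁ := (hη U _).1 hw₀ _ (Finset.mem_image_of_mem _ (Finset.mem_univ ⟨φ, hφ⟩))
    rw [PosFormula.realize_relabel, sumElim_comp_subst] at h₁
    rw [← show _ = φ from hφ₀ ⟨φ, hφ⟩, PosFormula.realize_relabel, sumElim_comp_subst]
    have h₂ : (fun z : π.K × Fin (m ⟨φ, hφ⟩) => w (z.1, e ⟨φ, hφ⟩ z.2)) =
        fun z => w₀ (z.1, t ⟨φ, hφ⟩ z.2) := by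
      funext z
      simp [w, t, hJ₀]
    rw [h₂]
    rwa [Function.comp_assoc, Function.comp_assoc, ht] at h₁
  have hcardJ : #(π.K × J) < κ := by
    rw [Cardinal.mk_prod]
    refine Cardinal.mul_lt_of_lt hκ.le ?_ (by simpa using hJ)
    refine lt_of_le_of_lt ?_ hκ
    simp
  have hrange : #(Set.range (Sum.elim a b)) < κ := by
    refine Cardinal.mk_range_le.trans_lt ?_
    rw [Cardinal.mk_sum]
    exact Cardinal.add_lt_of_lt hκ.le (by simpa using hJ) (by simpa using hJ)
  obtain ⟨w, -, hw⟩ := hsat _ hcardJ _ (Sum.elim a b) (fun _ => trivial) hrange p hp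
  have hw' : ∀ (m : ℕ) (e : Fin m → J) (φ₀ : PosFormula L ((π.K × Fin m) ⊕ (Fin m ⊕ Fin m))),
      π.IsConsequence U (e ⁻¹' Q) φ₀ →
        φ₀.Realize (Sum.elim (fun z => w (z.1, e z.2)) (Sum.elim (a ∘ e) (b ∘ e))) := by
    intro m e φ₀ h₀
    have := hw _ ⟨m, e, φ₀, h₀, rfl⟩
    rwa [PosFormula.realize_relabel, sumElim_comp_subst] at this
  refine h ⟨w, fun j => ?_, fun j => ?_, fun m e φ hφ => ?_, fun j hj k k' => ?_⟩
  · simpa using hw' 1 (fun _ => j) (PosFormula.eq (Sum.inl (π.fst, 0)) (Sum.inr (Sum.inl 0)))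
      fun w _ _ => by simp
  · simpa using hw' 1 (fun _ => j) (PosFormula.eq (Sum.inl (π.snd, 0)) (Sum.inr (Sum.inr 0)))
      fun w _ _ => by simp
  · have := hw' m e (φ.relabel Sum.inl) fun w hw _ => by
      rw [PosFormula.realize_relabel, Sum.elim_comp_inl]
      exact hw m id φ hφ
    rwa [PosFormula.realize_relabel, Sum.elim_comp_inl] at this
  · simpa using hw' 1 (fun _ => j) (PosFormula.eq (Sum.inl (k, 0)) (Sum.inl (k', 0)))
      fun w _ hwQ => by simpa using hwQ 0 hj k k'

theorem rel_of_finite {T : L.Theory} [Nonempty U] (hU : IsEC T U) {κ : Cardinal.{max u v}}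
    (hκ : ℵ₀ < κ) (hsat : SatIn L (Set.univ : Set U) κ) (π : Presentation L)
    {J : Type (max u v)} (hJ : #J < κ) (Q : Set J) (a b : J → U)
    (h : ∀ (m : ℕ) (e : Fin m → J), π.Rel (e ⁻¹' Q) (a ∘ e) (b ∘ e)) : π.Rel Q a b := by
  by_contra hn
  obtain ⟨m, e, ψ, h₁, h₂⟩ := exists_separating hU hκ hsat π hJ Q a b hn
  exact h₂ _ _ h₁ (h m e)

theorem Rel.of_realize {T : L.Theory} [Nonempty U] (hU : IsEC T U) {κ : Cardinal.{max u v}}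
    (hκ : ℵ₀ < κ) (hsat : SatIn L (Set.univ : Set U) κ) {π : Presentation L}
    {J : Type (max u v)} (hJ : #J < κ) {Q : Set J} {a b a' b' : J → U} (h : π.Rel Q a b)
    (htp : ∀ φ : PosFormula L (J ⊕ J), φ.Realize (Sum.elim a b) → φ.Realize (Sum.elim a' b')) :
    π.Rel Q a' b' := by
  by_contra hn
  obtain ⟨m, e, ψ, h₁, h₂⟩ := exists_separating hU hκ hsat π hJ Q a' b' hn
  refine h₂ _ _ ?_ (h.comp e)
  have := (hU.realize_iff_of_imp htp (ψ.relabel (Sum.map e e))).2 (by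
    rw [PosFormula.realize_relabel, Sum.elim_comp_map]
    exact h₁)
  rwa [PosFormula.realize_relabel, Sum.elim_comp_map] at this

/-- Equality. -/
def diag : Presentation L :=
  ⟨Unit, inferInstance, (), (), fun _ => ∅⟩

theorem rel_diag {Q : Set J} {a b : J → U} : (diag : Presentation L).Rel Q a b ↔ a = b := by
  constructor
  · rintro ⟨w, h₀, h₁, -⟩
    exact funext fun j => (h₀ j).symm.trans (h₁ j)
  · rintro rfl
    exact ⟨fun z => a z.2, fun _ => rfl, fun _ => rfl, fun _ _ _ h => h.elim,
      fun _ _ _ _ => rfl⟩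

/-- The inverse relation. -/
def flip (π : Presentation L) : Presentation L :=
  ⟨π.K, π.countable, π.snd, π.fst, π.cond⟩

theorem rel_flip {π : Presentation L} {Q : Set J} {a b : J → U} :
    π.flip.Rel Q a b ↔ π.Rel Q b a :=
  ⟨fun ⟨w, h₀, h₁, hw⟩ => ⟨w, h₁, h₀, hw⟩, fun ⟨w, h₀, h₁, hw⟩ => ⟨w, h₁, h₀, hw⟩⟩

/-- The composition of two relations. -/
def comp (π ρ : Presentation L) : Presentation L where
  K := π.K ⊕ ρ.K
  countable := by
    have := π.countable
    have := ρ.countable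
    infer_instance
  fst := Sum.inl π.fst
  snd := Sum.inr ρ.snd
  cond m := {φ | (∃ ψ ∈ π.cond m, ψ.relabel (Prod.map Sum.inl id) = φ) ∨
    (∃ ψ ∈ ρ.cond m, ψ.relabel (Prod.map Sum.inr id) = φ) ∨
      ∃ l, PosFormula.eq (Sum.inl π.snd, l) (Sum.inr ρ.fst, l) = φ}

theorem rel_comp {π ρ : Presentation L} {Q : Set J} {a b : J → U} :
    (π.comp ρ).Rel Q a b ↔ ∃ c : J → U, π.Rel Q a c ∧ ρ.Rel Q c b := by
  constructor
  · rintro ⟨w, h₀, h₁, hw, hQ⟩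
    refine ⟨fun j => w (Sum.inl π.snd, j),
      ⟨fun z => w (Sum.inl z.1, z.2), h₀, fun _ => rfl, fun m e φ hφ => ?_,
        fun j hj _ _ => hQ j hj _ _⟩,
      ⟨fun z => w (Sum.inr z.1, z.2), fun j => ?_, h₁, fun m e φ hφ => ?_,
        fun j hj _ _ => hQ j hj _ _⟩⟩
    · exact (PosFormula.realize_relabel φ (Prod.map Sum.inl id) fun z => w (z.1, e z.2)).1
        (hw m e _ (Or.inl ⟨φ, hφ, rfl⟩))
    · have := hw 1 (fun _ => j) _ (Or.inr (Or.inr ⟨0, rfl⟩))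
      exact ((PosFormula.realize_eq _ _ _).1 this).symm
    · exact (PosFormula.realize_relabel φ (Prod.map Sum.inr id) fun z => w (z.1, e z.2)).1
        (hw m e _ (Or.inr (Or.inl ⟨φ, hφ, rfl⟩)))
  · rintro ⟨c, ⟨w, h₀, h₁, hw, hQ⟩, w', h₀', h₁', hw', hQ'⟩
    refine ⟨fun z => Sum.elim (fun k => w (k, z.2)) (fun k => w' (k, z.2)) z.1, h₀, h₁', ?_, ?_⟩
    · rintro m e _ (⟨ψ, hψ, rfl⟩ | ⟨ψ, hψ, rfl⟩ | ⟨l, rfl⟩)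
      · exact (PosFormula.realize_relabel _ _ _).2 (hw m e ψ hψ)
      · exact (PosFormula.realize_relabel _ _ _).2 (hw' m e ψ hψ)
      · exact (PosFormula.realize_eq _ _ _).2 ((h₁ _).trans (h₀' _).symm)
    · have key : ∀ j ∈ Q, ∀ k, Sum.elim (fun k => w (k, j)) (fun k => w' (k, j)) k = c j := by
        rintro j hj (k | k)
        · exact (hQ j hj k π.snd).trans (h₁ j)
        · exact (hQ' j hj k ρ.fst).trans (h₀' j)
      exact fun j hj k k' => (key j hj k).trans (key j hj k').symm

end Presentation

end Presentation

/-! ### Extraction of indiscernible sequences in thick theories -/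

section Extraction

open Cardinal

theorem iteratedExp_lt_lambdaT (L : FirstOrder.Language.{u, v}) (k : ℕ) :
    iteratedExp (max ℵ₀ L.card) k < lambdaT L := by
  have hlim : IsStrongLimit (lambdaT L) := by
    refine isStrongLimit_beth.2 (isSuccLimit_ord ?_).isSuccPrelimit
    exact (le_max_left _ _).trans ((cantor _).le.trans (Order.le_succ _))
  induction k with
  | zero =>
    exact (cantor _).trans_le ((Order.le_succ _).trans (le_beth_ord _))
  | succ k ih => exact hlim.isStrongPrelimit ih

variable {L : FirstOrder.Language.{u, v}} {U : Type (max u v)} [L.Structure U]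

/-- Sets of conditions on increasing finite subsequences of a sequence of `m`-tuples. -/
abbrev Template (L : FirstOrder.Language.{u, v}) (m : ℕ) : Type (max u v) :=
  Set (Σ k : ℕ, PosFormula L (Fin k × Fin m))

/-- The sequence `d` satisfies the template `S`. -/
def Template.RealisedBy {m : ℕ} {I : Type x} [LinearOrder I] (S : Template L m)
    (d : I × Fin m → U) : Prop :=
  ∀ τ ∈ S, ∀ f : Fin τ.1 ↪o I, τ.2.Realize fun z => d (f z.1, z.2)

variable (U) in
/-- Finite subsets of the template are satisfied by infinite sequences. -/
def Template.FinCons {m : ℕ} (S : Template L m) : Prop :=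
  ∀ F : Finset (Σ k : ℕ, PosFormula L (Fin k × Fin m)), (F : Template L m) ⊆ S →
    ∃ d : ℕ × Fin m → U, Template.RealisedBy (F : Template L m) d

theorem Template.FinCons.exists_realisedBy {κ : Cardinal.{max u v}} (hκ : ℵ₀ ≤ κ)
    (hsat : SatIn L (Set.univ : Set U) κ) {m : ℕ} {S : Template L m} (hS : S.FinCons U)
    (I : Type (max u v)) [LinearOrder I] (hI : #I < κ) : ∃ d : I × Fin m → U, S.RealisedBy d := by
  classical
  let sub : ∀ {k : ℕ}, (Fin k ↪o I) → Fin k × Fin m → (I × Fin m) ⊕ PEmpty.{max u v + 1} :=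
    fun f z => Sum.inl (f z.1, z.2)
  let p : Set (PosFormula L ((I × Fin m) ⊕ PEmpty.{max u v + 1})) :=
    {φ | ∃ τ ∈ S, ∃ f : Fin τ.1 ↪o I, τ.2.relabel (sub f) = φ}
  have hcard : #(I × Fin m) < κ := by
    rw [mk_prod]
    exact mul_lt_of_lt hκ (by simpa using hI) ((lt_of_lt_of_le (by simp [natCast_lt_aleph0]) hκ))
  have hp : FinSat (PEmpty.elim : PEmpty.{max u v + 1} → U) p := by
    intro F hF
    have hF' : ∀ φ : F, φ.1 ∈ p := fun φ => hF φ.2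
    choose τ hτ f hf using hF'
    obtain ⟨d, hd⟩ := hS (Finset.univ.image τ) (by
      intro σ hσ
      obtain ⟨φ, -, rfl⟩ := Finset.mem_image.1 (Finset.mem_coe.1 hσ)
      exact hτ φ)
    let G : Finset I := Finset.univ.biUnion fun φ : F => Finset.univ.image (f φ)
    have hG : ∀ φ l, f φ l ∈ G := fun φ l =>
      Finset.mem_biUnion.2 ⟨φ, Finset.mem_univ _, Finset.mem_image_of_mem _ (Finset.mem_univ _)⟩
    -- Counting the members of `G` below `i` embeds the finitely many indices in use into ℕ in
    -- order.
    let ρ : I → ℕ := fun i => (G.filter (· < i)).card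
    have hρ : ∀ {i j}, i ∈ G → i < j → ρ i < ρ j := by
      intro i j hi hij
      refine Finset.card_lt_card ⟨fun l hl => ?_, fun h => ?_⟩
      · rw [Finset.mem_filter] at hl ⊢
        exact ⟨hl.1, hl.2.trans hij⟩
      · exact lt_irrefl i (Finset.mem_filter.1 (h (Finset.mem_filter.2 ⟨hi, hij⟩))).2
    refine ⟨fun z => d (ρ z.1, z.2), fun φ hφ => ?_⟩
    rw [← show _ = φ from hf ⟨φ, hφ⟩, PosFormula.realize_relabel]
    exact hd _ (Finset.mem_coe.2 (Finset.mem_image_of_mem _ (Finset.mem_univ ⟨φ, hφ⟩)))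
      (OrderEmbedding.ofStrictMono (fun l => ρ (f ⟨φ, hφ⟩ l)) fun l l' h =>
        hρ (hG _ _) ((f ⟨φ, hφ⟩).lt_iff_lt.2 h))
  obtain ⟨d, -, hd⟩ := hsat _ hcard _ PEmpty.elim (fun i => i.elim)
    (by rw [Set.range_eq_empty]; simpa using aleph0_pos.trans_le hκ) p hp
  refine ⟨d, fun τ hτ f => ?_⟩
  exact (PosFormula.realize_relabel τ.2 (sub f) _).1 (hd _ ⟨τ, hτ, f, rfl⟩)

theorem Template.RealisedBy.finCons {m : ℕ} {S : Template L m} {d : ℕ × Fin m → U}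
    (h : S.RealisedBy d) : S.FinCons U :=
  fun _ hF => ⟨d, fun τ hτ f => h τ (hF hτ) f⟩

theorem Template.FinCons.exists_maximal {m : ℕ} {S : Template L m} (hS : S.FinCons U) :
    ∃ S', S ⊆ S' ∧ Maximal (Template.FinCons U) S' := by
  refine zorn_subset_nonempty {S : Template L m | S.FinCons U} ?_ S hS
  intro c hc hchain hne
  refine ⟨⋃₀ c, fun F hF => ?_, fun s hs => Set.subset_sUnion_of_mem hs⟩
  obtain ⟨s, hs, hFs⟩ :=
    hchain.directedOn.exists_mem_subset_of_finite_of_subset_sUnion hne F.finite_toSet hF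
  exact hc hs F hFs

/-- A maximal template decides every formula. Stretch it to a sequence long enough for Erdős–Rado
and colour each tuple by `φ` or by a formula refuting `φ` that holds there. On a homogeneous
subsequence the constant colour is compatible with the template, so by maximality it belongs to it.
-/
theorem Template.exists_mem_of_maximal {T : L.Theory} [Nonempty U] (hU : IsEC T U)
    {κ : Cardinal.{max u v}} (hκ : ∀ k, iteratedExp (max ℵ₀ L.card) k < κ)
    (hsat : SatIn L (Set.univ : Set U) κ) {m : ℕ} {S : Template L m}
    (hS : Maximal (Template.FinCons U) S) {k : ℕ} (φ : PosFormula L (Fin (k + 1) × Fin m)) :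
    ∃ χ : PosFormula L (Fin (k + 1) × Fin m), (⟨k + 1, χ⟩ : Σ k, PosFormula L (Fin k × Fin m)) ∈ S ∧
      (χ = φ ∨ ∀ v : Fin (k + 1) × Fin m → U, φ.Realize v → ¬ χ.Realize v) := by
  classical
  have hc : ℵ₀ ≤ max ℵ₀ L.card := le_max_left _ _
  have hκ' : ℵ₀ ≤ κ := hc.trans (hκ 0).le
  let I := (Order.succ (iteratedExp (max ℵ₀ L.card) k)).ord.ToType
  have hI : #I = Order.succ (iteratedExp (max ℵ₀ L.card) k) := mk_ord_toType _
  obtain ⟨d, hd⟩ := hS.1.exists_realisedBy hκ' hsat I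
    (by rw [hI]; exact (Order.succ_le_of_lt (cantor _)).trans_lt (hκ (k + 1)))
  have hcol : ∀ t : Fin (k + 1) → I, ∃ χ : PosFormula L (Fin (k + 1) × Fin m),
      χ.Realize (fun z => d (t z.1, z.2)) ∧
        (χ = φ ∨ ∀ v : Fin (k + 1) × Fin m → U, φ.Realize v → ¬ χ.Realize v) := by
    intro t
    by_cases h : φ.Realize fun z => d (t z.1, z.2)
    · exact ⟨φ, h, Or.inl rfl⟩
    · obtain ⟨χ, h₁, h₂⟩ := hU.exists_contradicting φ _ h
      exact ⟨χ, h₁, Or.inr h₂⟩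
  choose col hcol hcol' using hcol
  have hK : #(PosFormula L (Fin (k + 1) × Fin m)) ≤ max ℵ₀ L.card := by
    refine (PosFormula.mk_le L _).trans (max_le hc ?_)
    refine add_le_of_le hc ?_ ?_
    · exact le_trans (by simpa using (natCast_lt_aleph0 (n := (k + 1) * m)).le) hc
    · simp
  obtain ⟨g, hg, χ, hχ⟩ := exists_homogeneous hc hK k (X := I) (by rw [hI]; exact Order.lt_succ _) col
  obtain ⟨r, hr, hgr⟩ := exists_strictMono_comp hg
  refine ⟨χ, ?_, ?_⟩
  · have hins : Template.FinCons U (insert ⟨k + 1, χ⟩ S) := by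
      refine Template.RealisedBy.finCons (d := fun z => d (g (r z.1), z.2)) ?_
      rintro τ (rfl | hτ) f
      · have h₁ : col (g ∘ (r ∘ f)) = χ := hχ (r ∘ f) (hr.comp f.strictMono)
        have h₂ := hcol (g ∘ (r ∘ f))
        rw [h₁] at h₂
        exact h₂
      · exact hd τ hτ (f.trans (OrderEmbedding.ofStrictMono _ hgr))
    exact hS.2 hins (Set.subset_insert _ _) (Set.mem_insert _ _)
  · have h₁ : col (g ∘ Fin.val) = χ := hχ Fin.val fun _ _ h => h
    rw [← h₁]
    exact hcol' _

/-- A template that is consistent with arbitrarily long sequences is satisfied by an indiscernible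
sequence. -/
theorem Template.FinCons.exists_indisc {T : L.Theory} [Nonempty U] (hU : IsEC T U)
    {κ : Cardinal.{max u v}} (hκ : ∀ k, iteratedExp (max ℵ₀ L.card) k < κ)
    (hsat : SatIn L (Set.univ : Set U) κ) {m : ℕ} {S : Template L m} (hS : S.FinCons U) :
    ∃ d : ℕ × Fin m → U, S.RealisedBy d ∧ Indisc L fun i l => d (i, l) := by
  obtain ⟨S', hSS', hS'⟩ := hS.exists_maximal
  have hκ' : ℵ₀ < κ := lt_of_le_of_lt (le_max_left _ _) (hκ 0)
  obtain ⟨d, hd⟩ := hS'.1.exists_realisedBy hκ'.le hsat (ULift.{max u v} ℕ) (by simpa using hκ')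
  let up : ℕ ↪o ULift.{max u v} ℕ := OrderEmbedding.ofStrictMono ULift.up fun _ _ h => h
  refine ⟨fun z => d (ULift.up z.1, z.2), fun τ hτ f => hd τ (hSS' hτ) (f.trans up), ?_⟩
  intro k f g φ
  cases k with
  | zero => rw [show f = g from RelEmbedding.ext fun i => i.elim0]
  | succ k =>
    obtain ⟨χ, hχ, rfl | hφ⟩ := Template.exists_mem_of_maximal hU hκ hsat hS' φ
    · exact iff_of_true (hd _ hχ (f.trans up)) (hd _ hχ (g.trans up))
    · exact iff_of_false (fun h => hφ _ h (hd _ hχ (f.trans up)))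
        fun h => hφ _ h (hd _ hχ (g.trans up))

end Extraction

/-! ### Distance in the sense of Lascar strong types -/

section Distance

open Cardinal

variable {L : FirstOrder.Language.{u, v}} {U : Type (max u v)} [L.Structure U]

variable (U) in
/-- `Θ` defines indiscernibility of sequences of finite tuples. -/
def DefinesIndisc (Θ : ∀ n : ℕ, Set (PosFormula L (ℕ × Fin n))) : Prop :=
  ∀ (n : ℕ) (s : ℕ → Fin n → U), (∀ θ ∈ Θ n, θ.Realize fun z => s z.1 z.2) ↔ Indisc L s

theorem IsThick.exists_definesIndisc {T : L.Theory} (hT : IsThick T) (hU : IsEC T U) :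
    ∃ Θ : ∀ n : ℕ, Set (PosFormula L (ℕ × Fin n)), DefinesIndisc U Θ := by
  choose Θ hpos hΘ using hT
  refine ⟨fun n => {θ | θ.1 ∈ Θ n}, fun n s => ?_⟩
  rw [← isIndiscernible_empty_iff, ← hΘ n U hU s]
  exact ⟨fun h θ hθ => h ⟨θ, hpos n θ hθ⟩ hθ, fun h θ hθ => h θ.1 hθ⟩

namespace Presentation

variable (Θ : ∀ n : ℕ, Set (PosFormula L (ℕ × Fin n)))

/-- `a` and `b` are the first two terms of an indiscernible sequence. -/
def indisc : Presentation L :=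
  ⟨ℕ, inferInstance, 0, 1, Θ⟩

/-- Some `c` is the second term of indiscernible sequences starting with `a` and with `b`. -/
def near : Presentation L :=
  (indisc Θ).comp (indisc Θ).flip

/-- `a` and `b` are connected by a chain of length `n`. -/
def chain : ℕ → Presentation L
  | 0 => diag
  | n + 1 => (chain n).comp (near Θ)

variable {Θ} {J : Type x}

theorem rel_indisc (hΘ : DefinesIndisc U Θ) {Q : Set J} {a b : J → U} :
    (indisc Θ).Rel Q a b ↔ ∃ s : ℕ → J → U, Indisc L s ∧ s 0 = a ∧ s 1 = b ∧
      ∀ j ∈ Q, ∀ i i', s i j = s i' j := by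
  constructor
  · rintro ⟨w, h₀, h₁, hw, hQ⟩
    refine ⟨fun i j => w (i, j), .of_finite fun m e => ?_, funext h₀, funext h₁, hQ⟩
    exact (hΘ m _).1 fun θ hθ => hw m e θ hθ
  · rintro ⟨s, hs, rfl, rfl, hQ⟩
    refine ⟨fun z => s z.1 z.2, fun _ => rfl, fun _ => rfl, fun m e θ hθ => ?_, hQ⟩
    exact (hΘ m _).2 (hs.comp e) θ hθ

theorem Rel.apply_eq {π : Presentation L} {Q : Set J} {a b : J → U} (h : π.Rel Q a b) {j : J}
    (hj : j ∈ Q) : a j = b j := by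
  obtain ⟨w, h₀, h₁, -, hQ⟩ := h
  rw [← h₀, ← h₁]
  exact hQ j hj _ _

theorem rel_near {Q : Set J} {a b : J → U} : (near Θ).Rel Q a b ↔
    ∃ c : J → U, (indisc Θ).Rel Q a c ∧ (indisc Θ).Rel Q b c := by
  simp only [near, rel_comp, rel_flip]

theorem rel_indisc_refl (hΘ : DefinesIndisc U Θ) (Q : Set J) (a : J → U) :
    (indisc Θ).Rel Q a a :=
  (rel_indisc hΘ).2 ⟨fun _ => a, indisc_const a, rfl, rfl, fun _ _ _ _ => rfl⟩

theorem Rel.near_of_indisc (hΘ : DefinesIndisc U Θ) {Q : Set J} {a b : J → U}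
    (h : (indisc Θ).Rel Q a b) : (near Θ).Rel Q a b :=
  rel_near.2 ⟨b, h, rel_indisc_refl hΘ Q b⟩

theorem Rel.near_symm {Q : Set J} {a b : J → U} (h : (near Θ).Rel Q a b) :
    (near Θ).Rel Q b a := by
  obtain ⟨c, h₁, h₂⟩ := rel_near.1 h
  exact rel_near.2 ⟨c, h₂, h₁⟩

/-- The coordinates of a tuple with appended parameters that hold the parameters. -/
abbrev params (J : Type x) (C : Type y) : Set (J ⊕ C) :=
  Set.range Sum.inr

theorem near_of_onIndiscernible (hΘ : DefinesIndisc U Θ) {C : Set U} {a b : J → U}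
    (h : OnIndiscernible L C a b) :
    (near Θ).Rel (params J C) (Sum.elim a ((↑) : C → U)) (Sum.elim b ((↑) : C → U)) := by
  obtain ⟨s, hs, i, j, rfl, rfl⟩ := h
  have key : ∀ i j, i < j → (near Θ).Rel (params J C) (Sum.elim (s i) ((↑) : C → U))
      (Sum.elim (s j) ((↑) : C → U)) := by
    intro i j hij
    refine Rel.near_of_indisc hΘ ((rel_indisc hΘ).2 ?_)
    -- The subsequence i, j, j+1, j+2, …, whose first two terms are the given ones.
    let r : ℕ ↪o ℕ := OrderEmbedding.ofStrictMono (fun n => if n = 0 then i else j + n - 1) (by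
      intro m n hmn
      beta_reduce
      split_ifs <;> omega)
    refine ⟨fun n => Sum.elim (s (r n)) ((↑) : C → U), hs.indisc_sumElim.subseq r, ?_, ?_, ?_⟩
    · exact congrArg (fun i => Sum.elim (s i) _) (show r 0 = i from rfl)
    · exact congrArg (fun i => Sum.elim (s i) _) (show r 1 = j from rfl)
    · rintro _ ⟨c, rfl⟩ _ _
      rfl
  rcases lt_trichotomy i j with h | rfl | h
  · exact key i j h
  · exact (rel_indisc_refl hΘ _ _).near_of_indisc hΘ
  · exact (key j i h).near_symm

theorem onIndiscernible_of_rel (hΘ : DefinesIndisc U Θ) {C : Set U} {a b : J → U}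
    (h : (indisc Θ).Rel (params J C) (Sum.elim a ((↑) : C → U)) (Sum.elim b ((↑) : C → U))) :
    OnIndiscernible L C a b := by
  obtain ⟨s, hs, h₀, h₁, hQ⟩ := (rel_indisc hΘ).1 h
  refine ⟨fun i j => s i (Sum.inl j), Indisc.isIndiscernible ?_, 0, 1, ?_, ?_⟩
  · convert hs using 2 with i
    funext z
    rcases z with j | c
    · rfl
    · rw [hQ _ ⟨c, rfl⟩ i 0, h₀]
      rfl
  · simp [h₀]
  · simp [h₁]

theorem Rel.exists_eq_sumElim {π : Presentation L} {C : Set U} {a : J → U} {z : J ⊕ C → U}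
    (h : π.Rel (params J C) (Sum.elim a ((↑) : C → U)) z) :
    ∃ b : J → U, z = Sum.elim b ((↑) : C → U) := by
  refine ⟨z ∘ Sum.inl, funext fun j => ?_⟩
  rcases j with j | c
  · rfl
  · exact (h.apply_eq ⟨c, rfl⟩).symm

theorem _root_.PosLogic.OnIndiscernible.symm {C : Set U} {a b : J → U}
    (h : OnIndiscernible L C a b) : OnIndiscernible L C b a := by
  obtain ⟨s, hs, i, j, h⟩ := h
  exact ⟨s, hs, j, i, h.symm⟩

theorem _root_.PosLogic.LsEquiv.symm {C : Set U} {a b : J → U} (h : LsEquiv L C a b) :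
    LsEquiv L C b a := by
  induction h with
  | refl => exact .refl
  | tail _ h ih => exact .head (OnIndiscernible.symm h) ih

theorem lsEquiv_of_rel_near (hΘ : DefinesIndisc U Θ) {C : Set U} {a b : J → U}
    (h : (near Θ).Rel (params J C) (Sum.elim a ((↑) : C → U)) (Sum.elim b ((↑) : C → U))) :
    LsEquiv L C a b := by
  obtain ⟨_, h₁, h₂⟩ := rel_near.1 h
  obtain ⟨c, rfl⟩ := h₁.exists_eq_sumElim
  exact .tail (.single (onIndiscernible_of_rel hΘ h₁)) (onIndiscernible_of_rel hΘ h₂).symm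

theorem lsEquiv_iff_exists_chain (hΘ : DefinesIndisc U Θ) {C : Set U} {a b : J → U} :
    LsEquiv L C a b ↔ ∃ n, (chain Θ n).Rel (params J C)
      (Sum.elim a ((↑) : C → U)) (Sum.elim b ((↑) : C → U)) := by
  constructor
  · intro h
    induction h with
    | refl => exact ⟨0, rel_diag.2 rfl⟩
    | tail _ h ih =>
      obtain ⟨n, hn⟩ := ih
      exact ⟨n + 1, rel_comp.2 ⟨_, hn, near_of_onIndiscernible hΘ h⟩⟩
  · rintro ⟨n, hn⟩
    induction n generalizing b with
    | zero =>
      have : a = b := by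
        funext j
        exact congrFun (rel_diag.1 hn) (Sum.inl j)
      exact this ▸ .refl
    | succ n ih =>
      obtain ⟨_, h₁, h₂⟩ := rel_comp.1 hn
      obtain ⟨c, rfl⟩ := h₁.exists_eq_sumElim
      exact (ih h₁).trans (lsEquiv_of_rel_near hΘ h₂)

/-- A formula that excludes indiscernibility does not hold along an infinite sequence. -/
theorem not_forall_lt_realize {T : L.Theory} [Nonempty U] (hU : IsEC T U)
    {κ : Cardinal.{max u v}} (hκ : ∀ k, iteratedExp (max ℵ₀ L.card) k < κ)
    (hsat : SatIn L (Set.univ : Set U) κ) (hΘ : DefinesIndisc U Θ) {m : ℕ} {Q : Set (Fin m)}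
    {ψ : PosFormula L (Fin m ⊕ Fin m)}
    (hψ : ∀ a b : Fin m → U, ψ.Realize (Sum.elim a b) → ¬ (indisc Θ).Rel Q a b)
    (d : ℕ → Fin m → U) (hQ : ∀ j ∈ Q, ∀ i i', d i j = d i' j) :
    ¬ ∀ i j, i < j → ψ.Realize (Sum.elim (d i) (d j)) := by
  intro h
  -- The sequence `d` realises "`ψ` on increasing pairs, constant on `Q`", so an indiscernible
  -- sequence does too. Its first two terms satisfy both `ψ` and the relation that `ψ` excludes.
  let S : Template L m := {τ | τ = ⟨2, ψ.relabel (Sum.elim (fun l => (0, l)) fun l => (1, l))⟩ ∨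
    ∃ l ∈ Q, τ = ⟨2, PosFormula.eq ((0 : Fin 2), l) ((1 : Fin 2), l)⟩}
  have hψS : ∀ (d : ℕ × Fin m → U) (f : Fin 2 ↪o ℕ),
      (ψ.relabel (Sum.elim (fun l => ((0 : Fin 2), l)) fun l => ((1 : Fin 2), l))).Realize
        (fun z => d (f z.1, z.2)) ↔
          ψ.Realize (Sum.elim (fun l => d (f 0, l)) fun l => d (f 1, l)) := by
    intro d f
    rw [PosFormula.realize_relabel, Sum.comp_elim]
    rfl
  have hS : S.RealisedBy fun z : ℕ × Fin m => d z.1 z.2 := by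
    rintro _ (rfl | ⟨l, hl, rfl⟩) f
    · exact (hψS (fun z => d z.1 z.2) f).2 (h _ _ (f.lt_iff_lt.2 Fin.zero_lt_one))
    · exact (PosFormula.realize_eq _ _ _).2 (hQ l hl _ _)
  obtain ⟨d', hd', hind⟩ := hS.finCons.exists_indisc hU hκ hsat
  let pr : ∀ i j : ℕ, i < j → (Fin 2 ↪o ℕ) := fun i j hij =>
    OrderEmbedding.ofStrictMono ![i, j] (by
      intro x y hxy
      fin_cases x <;> fin_cases y <;> simp_all)
  refine hψ (fun l => d' (0, l)) (fun l => d' (1, l)) ?_ ((rel_indisc hΘ).2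
    ⟨fun i l => d' (i, l), hind, rfl, rfl, ?_⟩)
  · exact (hψS d' (pr 0 1 one_pos)).1 (hd' _ (Or.inl rfl) (pr 0 1 one_pos))
  · have key : ∀ j ∈ Q, ∀ i i', i < i' → d' (i, j) = d' (i', j) := fun j hj i i' hi =>
      (PosFormula.realize_eq ((0 : Fin 2), j) ((1 : Fin 2), j) fun z => d' (pr i i' hi z.1, z.2)).1
        (hd' _ (Or.inr ⟨j, hj, rfl⟩) (pr i i' hi))
    intro j hj i i'
    rcases lt_trichotomy i i' with hi | rfl | hi
    · exact key j hj i i' hi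
    · rfl
    · exact (key j hj i' i hi).symm

end Presentation

end Distance

/-! ### Equality of types over a small set of representatives implies Lascar equivalence -/

section Representatives

open Cardinal Presentation

variable {L : FirstOrder.Language.{u, v}} {U : Type (max u v)} [L.Structure U]

/-- The properties of the ambient model that are used: it is existentially closed, saturated beyond
the iterated exponentials of the number of formulas, and indiscernibility is type-definable. -/
structure IsThickMonster (T : L.Theory) (U : Type (max u v)) [L.Structure U]
    (κ : Cardinal.{max u v}) (Θ : ∀ n : ℕ, Set (PosFormula L (ℕ × Fin n))) : Prop where
  ec : IsEC T U
  lt : ∀ k, iteratedExp (max ℵ₀ L.card) k < κ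
  sat : SatIn L (Set.univ : Set U) κ
  defines : DefinesIndisc U Θ

/-- The tuple `a` with the elements of `C` appended. -/
abbrev append {J : Type x} {M : Type w} (a : J → M) (C : Set M) : J ⊕ C → M :=
  Sum.elim a ((↑) : C → M)

/-- A common point at distance one from `a` and `b` over `C`, in the sense of `near`. -/
def NearOver (Θ : ∀ n : ℕ, Set (PosFormula L (ℕ × Fin n))) (C : Set U) {J : Type x}
    (a b : J → U) : Prop :=
  (near Θ).Rel (params J C) (append a C) (append b C)

variable {T : L.Theory} {κ : Cardinal.{max u v}} {Θ : ∀ n : ℕ, Set (PosFormula L (ℕ × Fin n))}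

theorem IsThickMonster.aleph0_lt (h : IsThickMonster T U κ Θ) : ℵ₀ < κ :=
  lt_of_le_of_lt (le_max_left _ _) (h.lt 0)

/-- Colour a pair by a formula on a finite subtuple that excludes an indiscernible sequence through
it. There are at most |C| + |T| colours, so beyond 2^(|C| + |T|) points Erdős–Rado for pairs yields
an infinite sequence with one colour, which extraction forbids. -/
theorem IsThickMonster.mk_le_of_pairwise [Nonempty U] (h : IsThickMonster T U κ Θ) {C : Set U}
    (hC : #C < κ) {n : ℕ} {X : Set (Fin n → U)} (hX : X.Pairwise fun x y => ¬ NearOver Θ C x y) :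
    #X ≤ 2 ^ (#C + max ℵ₀ L.card) := by
  classical
  by_contra hlt
  rw [not_le] at hlt
  have hc : ℵ₀ ≤ #C + max ℵ₀ L.card := (le_max_left _ _).trans (self_le_add_left _ _)
  let K := Σ m : ℕ, (Fin m → Fin n ⊕ C) × PosFormula L (Fin m ⊕ Fin m)
  have hnC : #(Fin n ⊕ C) ≤ #C + max ℵ₀ L.card := by
    rw [mk_sum]
    refine add_le_of_le hc ?_ ?_
    · exact le_trans (by simp) hc
    · simp
  have hK : #K ≤ #C + max ℵ₀ L.card := by
    rw [mk_sigma]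
    refine (sum_le_sum _ (fun _ => #C + max ℵ₀ L.card) fun m => ?_).trans ?_
    · rw [mk_prod, lift_id, lift_id]
      refine mul_le_of_le hc ?_ ?_
      · have : #(Fin m → Fin n ⊕ C) = #(Fin n ⊕ C) ^ m := by simp
        rw [this]
        exact (power_le_power_right hnC).trans (power_nat_le hc)
      · refine le_trans ((PosFormula.mk_le L _).trans (max_le (le_max_left _ _) ?_)) (self_le_add_left _ _)
        refine add_le_of_le (le_max_left _ _) ?_ ?_
        · exact le_trans (by simp) (le_max_left _ _)
        · simp
    · simp only [sum_const, mk_nat, lift_aleph0, lift_id']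
      refine mul_le_of_le hc ?_ ?_ <;> simp [hc]
  have hcard : #(Fin n ⊕ C) < κ := by
    rw [mk_sum]
    refine add_lt_of_lt h.aleph0_lt.le ?_ (by simpa using hC)
    exact lt_of_lt_of_le (by simp [natCast_lt_aleph0]) h.aleph0_lt.le
  have hcol : ∀ t : Fin 2 → X, ∃ z : K, t 0 ≠ t 1 →
      z.2.2.Realize (Sum.elim (append (t 0).1 C ∘ z.2.1) (append (t 1).1 C ∘ z.2.1)) ∧
        ∀ a b : Fin z.1 → U, z.2.2.Realize (Sum.elim a b) →
          ¬ (indisc Θ).Rel (z.2.1 ⁻¹' params (Fin n) C) a b := by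
    intro t
    by_cases ht : t 0 = t 1
    -- Junk colour for the diagonal; only pairs of distinct points are used.
    · exact ⟨⟨0, Fin.elim0, ⟨⊤, .verum⟩⟩, fun h => (h ht).elim⟩
    · obtain ⟨m, e, ψ, h₁, h₂⟩ := exists_separating h.ec h.aleph0_lt h.sat (indisc Θ) hcard
        (params (Fin n) C) (append (t 0).1 C) (append (t 1).1 C) fun hr =>
          hX (t 0).2 (t 1).2 (fun h => ht (Subtype.ext h)) (hr.near_of_indisc h.defines)
      exact ⟨⟨m, e, ψ⟩, fun _ => ⟨h₁, h₂⟩⟩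
  choose col hcol using hcol
  obtain ⟨g, hg, ⟨m, e, ψ⟩, hψ⟩ := exists_homogeneous hc hK 1 (X := X) hlt col
  have hfin : ∀ i j, i < j →
      ψ.Realize (Sum.elim (append (g i).1 C ∘ e) (append (g j).1 C ∘ e)) ∧
        ∀ a b : Fin m → U, ψ.Realize (Sum.elim a b) →
          ¬ (indisc Θ).Rel (e ⁻¹' params (Fin n) C) a b := by
    intro i j hij
    have h₁ := hψ ![i, j] (by
      intro x y hxy
      fin_cases x <;> fin_cases y <;> simp_all)
    have h₂ := hcol (g ∘ ![i, j]) fun he => hij.ne (hg he)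
    rw [h₁] at h₂
    exact h₂
  refine not_forall_lt_realize h.ec h.lt h.sat h.defines (hfin 0 1 one_pos).2
    (fun i => append (g i).1 C ∘ e) ?_ fun i j hij => (hfin i j hij).1
  rintro l ⟨c, hc⟩ i i'
  simp [← hc]

/-- A maximal set of tuples from `N` that are pairwise not near. -/
theorem exists_maximal_pairwise (C N : Set U) (n : ℕ) :
    ∃ X : Set (Fin n → U), Maximal (fun X : Set (Fin n → U) =>
      (∀ x ∈ X, ∀ l, x l ∈ N) ∧ X.Pairwise fun x y => ¬ NearOver Θ C x y) X := by
  refine zorn_subset {X : Set (Fin n → U) | (∀ x ∈ X, ∀ l, x l ∈ N) ∧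
    X.Pairwise fun x y => ¬ NearOver Θ C x y} fun c hc hchain => ⟨⋃₀ c, ⟨?_, ?_⟩, fun s hs =>
      Set.subset_sUnion_of_mem hs⟩
  · rintro x ⟨s, hs, hx⟩
    exact (hc hs).1 x hx
  · exact (Set.pairwise_sUnion hchain.directedOn).2 fun s hs => (hc hs).2

/-- If `a` were near no member of `X`, the formulas witnessing this would involve at most μ
parameters from `N`. Saturation would realise them by some `y` in `N`, and `y` would properly extend
the maximal set. -/
theorem IsThickMonster.exists_nearOver [Nonempty U] (h : IsThickMonster T U κ Θ) {C N : Set U}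
    (hCN : C ⊆ N) (hC : #C < κ) {μ : Cardinal.{max u v}} (hμ : 2 ^ (#C + max ℵ₀ L.card) ≤ μ)
    (hN : SatIn L N (Order.succ μ)) {n : ℕ} {X : Set (Fin n → U)}
    (hX : Maximal (fun X : Set (Fin n → U) =>
      (∀ x ∈ X, ∀ l, x l ∈ N) ∧ X.Pairwise fun x y => ¬ NearOver Θ C x y) X) (a : Fin n → U) :
    ∃ x ∈ X, NearOver Θ C a x := by
  classical
  by_contra! H
  have hcμ : #C + max ℵ₀ L.card ≤ μ := (cantor _).le.trans hμ
  have hμ₀ : ℵ₀ ≤ μ := ((le_max_left _ _).trans (self_le_add_left _ _)).trans hcμ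
  have hcard : #(Fin n ⊕ C) < κ := by
    rw [mk_sum]
    refine add_lt_of_lt h.aleph0_lt.le ?_ (by simpa using hC)
    exact lt_of_lt_of_le (by simp [natCast_lt_aleph0]) h.aleph0_lt.le
  have hsep := fun x : X => exists_separating h.ec h.aleph0_lt h.sat (near Θ) hcard
    (params (Fin n) C) (append a C) (append x.1 C) (H x.1 x.2)
  choose m e ψ h₁ h₂ using hsep
  let c : (X × Fin n) ⊕ C → U := Sum.elim (fun z => z.1.1 z.2) ((↑) : C → U)
  let r : ∀ x : X, Fin (m x) ⊕ Fin (m x) → ULift.{max u v} (Fin n) ⊕ ((X × Fin n) ⊕ C) :=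
    fun x => Sum.elim
      (fun l => Sum.elim (fun i => Sum.inl (ULift.up i)) (fun c => Sum.inr (Sum.inr c)) (e x l))
      (fun l => Sum.elim (fun i => Sum.inr (Sum.inl (x, i))) (fun c => Sum.inr (Sum.inr c)) (e x l))
  have hr : ∀ (x : X) (y : Fin n → U), ((ψ x).relabel (r x)).Realize
      (Sum.elim (fun i => y i.down) c) ↔
        (ψ x).Realize (Sum.elim (append y C ∘ e x) (append x.1 C ∘ e x)) := by
    intro x y
    rw [PosFormula.realize_relabel, iff_iff_eq]
    refine congrArg (ψ x).Realize (funext fun z => ?_)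
    rcases z with l | l <;> simp only [r, Function.comp_apply, Sum.elim_inl, Sum.elim_inr] <;>
      rcases e x l with i | i <;> rfl
  obtain ⟨y, hyN, hy⟩ := hN (ULift.{max u v} (Fin n))
    (by
      refine Order.lt_succ_iff.2 (le_trans ?_ hμ₀)
      simp) _ c
    (by
      rintro (z | z)
      · exact hX.1.1 _ z.1.2 _
      · exact hCN z.2)
    (by
      refine Order.lt_succ_iff.2 (mk_range_le.trans ?_)
      rw [mk_sum, lift_id, lift_id, mk_prod, lift_uzero]
      refine add_le_of_le hμ₀ (mul_le_of_le hμ₀ ?_ ?_) ((self_le_add_right _ _).trans hcμ)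
      · exact (h.mk_le_of_pairwise hC hX.1.2).trans hμ
      · exact le_trans (by simp) hμ₀)
    (Set.range fun x => (ψ x).relabel (r x)) (by
      intro F hF
      refine ⟨fun i => a i.down, fun φ hφ => ?_⟩
      obtain ⟨x, rfl⟩ := hF hφ
      exact (hr x a).2 (h₁ x))
  have hfar : ∀ x ∈ X, ¬ NearOver Θ C (fun i => y (ULift.up i)) x := fun x hx hnear =>
    h₂ ⟨x, hx⟩ _ _ ((hr ⟨x, hx⟩ fun i => y (ULift.up i)).1 (hy _ ⟨⟨x, hx⟩, rfl⟩))
      (Rel.comp hnear _)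
  have hins := hX.2 (y := insert (fun i => y (ULift.up i)) X) ⟨?_, ?_⟩ (Set.subset_insert _ _)
    (Set.mem_insert _ _)
  · exact hfar _ hins ((rel_indisc_refl h.defines _ _).near_of_indisc h.defines)
  · rintro x (rfl | hx) l
    · exact hyN _
    · exact hX.1.1 x hx l
  · refine Set.pairwise_insert.2 ⟨hX.1.2, fun x hx _ => ⟨hfar x hx, fun hn => ?_⟩⟩
    exact hfar x hx hn.near_symm

/-- There is a small set `D` such that tuples with the same type over `D` are Lascar equivalent. -/
theorem IsThickMonster.exists_representatives [Nonempty U] (h : IsThickMonster T U κ Θ)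
    {C N : Set U} (hCN : C ⊆ N) (hC : #C < κ) {μ : Cardinal.{max u v}}
    (hμ : 2 ^ (#C + max ℵ₀ L.card) ≤ μ) (hN : SatIn L N (Order.succ μ)) :
    ∃ D : Set U, D ⊆ N ∧ #D ≤ μ ∧ ∀ (J : Type (max u v)), #J < κ → ∀ a a' : J → U,
      (∀ φ : PosFormula L (J ⊕ D), φ.Realize (append a D) → φ.Realize (append a' D)) →
        LsEquiv L C a a' := by
  classical
  have hcμ : #C + max ℵ₀ L.card ≤ μ := (cantor _).le.trans hμ
  have hμ₀ : ℵ₀ ≤ μ := ((le_max_left _ _).trans (self_le_add_left _ _)).trans hcμ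
  choose X hX using exists_maximal_pairwise (Θ := Θ) C N
  let D : Set U := C ∪ Set.range fun z : Σ n, X n × Fin n => z.2.1.1 z.2.2
  refine ⟨D, ?_, ?_, ?_⟩
  · rintro _ (hc | ⟨z, rfl⟩)
    · exact hCN hc
    · exact (hX z.1).1.1 _ z.2.1.2 _
  · refine (mk_union_le _ _).trans (add_le_of_le hμ₀ ((self_le_add_right _ _).trans hcμ) ?_)
    refine mk_range_le.trans ?_
    rw [mk_sigma]
    refine (sum_le_sum _ (fun _ => μ) fun n => ?_).trans ?_
    · rw [mk_prod, lift_uzero]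
      refine mul_le_of_le hμ₀ ((h.mk_le_of_pairwise hC (hX n).1.2).trans hμ) ?_
      exact le_trans (by simp) hμ₀
    · simp only [sum_const, mk_nat, lift_aleph0, lift_id']
      refine mul_le_of_le hμ₀ ?_ ?_ <;> simp [hμ₀]
  intro J hJ a a' htp
  rcases isEmpty_or_nonempty J with hJe | ⟨⟨j₀⟩⟩
  · rw [Subsingleton.elim a a']
    exact .refl
  refine (lsEquiv_iff_exists_chain h.defines).2 ⟨2, ?_⟩
  have hcard : ∀ {J : Type (max u v)}, #J < κ → #(J ⊕ C) < κ := by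
    intro J hJ
    rw [mk_sum]
    exact add_lt_of_lt h.aleph0_lt.le (by simpa using hJ) (by simpa using hC)
  refine rel_of_finite h.ec h.aleph0_lt h.sat _ (hcard hJ) _ _ _ fun m e => ?_
  -- A finite selection from `J ⊕ C` is split into a finite subtuple of `J`, with the dummy `j₀` at
  -- the places of parameters, and a map `e''` that puts the parameters back.
  let e' : Fin m → J := fun l => Sum.elim id (fun _ => j₀) (e l)
  let e'' : Fin m → Fin m ⊕ C := fun l => Sum.elim (fun _ => Sum.inl l) Sum.inr (e l)
  have happ : ∀ a : J → U, append a C ∘ e = append (a ∘ e') C ∘ e'' := by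
    intro a
    funext l
    simp only [Function.comp_apply, e'', e']
    rcases hl : e l with j | c <;> simp [hl]
  have hpre : e ⁻¹' params J C = e'' ⁻¹' params (Fin m) C := by
    ext l
    simp only [Set.mem_preimage, e'']
    rcases e l with j | c <;> simp
  rw [happ, happ, hpre]
  refine Rel.comp ?_ e''
  obtain ⟨x, hx, hnear⟩ := h.exists_nearOver hCN hC hμ hN (hX m) (a ∘ e')
  have hnear' : NearOver Θ C (a' ∘ e') x := by
    have hcard' : #(Fin m ⊕ C) < κ := by
      rw [mk_sum]
      refine add_lt_of_lt h.aleph0_lt.le ?_ (by simpa using hC)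
      exact lt_of_lt_of_le (by simp [natCast_lt_aleph0]) h.aleph0_lt.le
    refine Rel.of_realize h.ec h.aleph0_lt h.sat (J := Fin m ⊕ C) hcard' hnear fun φ hφ => ?_
    let r : (Fin m ⊕ C) ⊕ (Fin m ⊕ C) → J ⊕ D := Sum.elim
      (Sum.elim (fun l => Sum.inl (e' l)) fun c => Sum.inr ⟨c, Or.inl c.2⟩)
      (Sum.elim (fun l => Sum.inr ⟨x l, Or.inr ⟨⟨m, ⟨x, hx⟩, l⟩, rfl⟩⟩)
        fun c => Sum.inr ⟨c, Or.inl c.2⟩)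
    have hr : ∀ a : J → U, append a D ∘ r = Sum.elim (append (a ∘ e') C) (append x C) := by
      intro a
      funext z
      rcases z with (l | c) | (l | c) <;> rfl
    have := htp (φ.relabel r)
    rw [PosFormula.realize_relabel, PosFormula.realize_relabel, hr, hr] at this
    exact this hφ
  -- The path from the first tuple to `x` to the second one. Its length is 2 whatever the finite
  -- subtuple, and this uniformity is what allows compactness.
  exact rel_comp.2 ⟨_, rel_comp.2 ⟨_, rel_diag.2 rfl, hnear⟩, hnear'.near_symm⟩

end Representatives

/-! ### Extending Lascar-invariant types -/

section Extension

open Cardinal Presentation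

variable {L : FirstOrder.Language.{u, v}} {U : Type (max u v)} [L.Structure U]

theorem PosFormula.exists_finite_params {α : Type x} {β : Type y} (φ : PosFormula L (α ⊕ β)) :
    ∃ (F : Finset β) (χ : PosFormula L (α ⊕ F)), ∀ v : α ⊕ β → U,
      φ.Realize v ↔ χ.Realize (v ∘ Sum.map id (↑)) := by
  classical
  obtain ⟨F₀, χ, hχ⟩ := φ.exists_finite_support
  let F : Finset β := F₀.preimage Sum.inr Sum.inr_injective.injOn
  let r : F₀ → α ⊕ F := fun z => match z with
    | ⟨Sum.inl a, _⟩ => Sum.inl a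
    | ⟨Sum.inr b, h⟩ => Sum.inr ⟨b, Finset.mem_preimage.2 h⟩
  refine ⟨F, χ.relabel r, fun v => ?_⟩
  rw [PosFormula.realize_relabel, ← hχ, iff_iff_eq]
  refine congrArg χ.Realize (funext fun z => ?_)
  rcases z with ⟨a | b, h⟩ <;> rfl

theorem OnIndiscernible.comp {C : Set U} {J : Type x} {J' : Type y} {a b : J → U}
    (h : OnIndiscernible L C a b) (e : J' → J) : OnIndiscernible L C (a ∘ e) (b ∘ e) := by
  obtain ⟨s, hs, i, j, rfl, rfl⟩ := h
  refine ⟨fun i => s i ∘ e, Indisc.isIndiscernible ?_, i, j, rfl, rfl⟩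
  convert hs.indisc_sumElim.comp (Sum.map e id) using 2
  rw [Sum.elim_comp_map]
  rfl

theorem LsEquiv.comp {C : Set U} {J : Type x} {J' : Type y} {a b : J → U}
    (h : LsEquiv L C a b) (e : J' → J) : LsEquiv L C (a ∘ e) (b ∘ e) := by
  induction h with
  | refl => exact .refl
  | tail _ h ih => exact ih.tail (OnIndiscernible.comp h e)

theorem LsEquiv.realize_iff {C : Set U} {J : Type x} {a b : J → U} (h : LsEquiv L C a b)
    (φ : PosFormula L J) : φ.Realize a ↔ φ.Realize b := by
  induction h with
  | refl => exact Iff.rfl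
  | tail _ h ih =>
    refine ih.trans ?_
    obtain ⟨s, hs, i, j, rfl, rfl⟩ := h
    have := hs 1 (OrderEmbedding.ofStrictMono (fun _ => i) fun x y h => (by omega))
      (OrderEmbedding.ofStrictMono (fun _ => j) fun x y h => (by omega))
      (φ.relabel fun j => Sum.inl ((0 : Fin 1), j)).1 (φ.relabel _).2
    exact ((PosFormula.realize_relabel φ _ _).symm.trans this).trans
      (PosFormula.realize_relabel φ _ _)

theorem IsType.mem_iff {ι : Type x} {B : Set U} {p : Set (L.Formula (ι ⊕ B))} (hp : IsType B p)
    {α : ι → U} (hα : Realises α p) (φ : PosFormula L (ι ⊕ B)) :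
    φ.1 ∈ p ↔ φ.Realize (append α B) := by
  refine ⟨fun h => hα _ h, fun h => ?_⟩
  have : IsPartialType B {φ : L.Formula (ι ⊕ B) | IsPositive φ ∧ Holds φ α} :=
    ⟨fun φ h => h.1, fun F hF => ⟨α, fun φ hφ => (hF hφ).2⟩⟩
  exact hp.2 this (fun ψ hψ => ⟨hp.1.1 ψ hψ, hα ψ hψ⟩) ⟨φ.2, h⟩

theorem IsType.ext_of_realises {ι : Type x} {B : Set U} {p q : Set (L.Formula (ι ⊕ B))}
    (hp : IsType B p) (hq : IsType B q)
    (h : ∀ φ : PosFormula L (ι ⊕ B), φ.1 ∈ p ↔ φ.1 ∈ q) : p = q := by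
  ext φ
  exact ⟨fun hφ => (h ⟨φ, hp.1.1 φ hφ⟩).1 hφ, fun hφ => (h ⟨φ, hq.1.1 φ hφ⟩).2 hφ⟩

variable (L) in
/-- Every tuple of length at most `μ` has a representative in `N`, Lascar equivalent over `C` even
after `D` is appended. -/
def HasReps (C N D : Set U) (μ : Cardinal.{max u v}) : Prop :=
  ∀ (K : Type (max u v)), #K ≤ μ → ∀ b : K → U, ∃ β : K → U, (∀ k, β k ∈ N) ∧
    LsEquiv L C (append b D) (append β D)

variable (L) in
/-- `α` realises a Lascar-invariant type over `N`. -/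
def InvariantOver (C N : Set U) {ι : Type (max u v)} (α : ι → U) : Prop :=
  ∀ (J : Type (max u v)) (b b' : J → U), (∀ j, b j ∈ N) → (∀ j, b' j ∈ N) →
    LsEquiv L C b b' → LsEquiv L C (Sum.elim α b) (Sum.elim α b')

variable {C N D : Set U} {μ : Cardinal.{max u v}} {ι : Type (max u v)} {α : ι → U}

theorem HasReps.exists_lsEquiv (h : HasReps L C N D μ) {K : Type (max u v)} (hK : #K ≤ μ)
    (b : K → U) : ∃ β : K → U, (∀ k, β k ∈ N) ∧ LsEquiv L C b β := by
  obtain ⟨β, hβ, hb⟩ := h K hK b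
  exact ⟨β, hβ, hb.comp Sum.inl⟩

theorem InvariantOver.realize_iff (h : InvariantOver L C N α) {K : Type (max u v)} {b b' : K → U}
    (hb : ∀ k, b k ∈ N) (hb' : ∀ k, b' k ∈ N) (hbb : LsEquiv L C b b')
    (φ : PosFormula L (ι ⊕ K)) : φ.Realize (Sum.elim α b) ↔ φ.Realize (Sum.elim α b') :=
  (h K b b' hb hb' hbb).realize_iff φ

variable (L) in
/-- The formulas over `B` that hold of `α` after their parameters have been replaced by
representatives in `N`. -/
def extendType (C N B : Set U) {ι : Type (max u v)} (α : ι → U) : Set (L.Formula (ι ⊕ B)) :=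
  {φ | IsPositive φ ∧ ∃ (F : Finset B) (χ : PosFormula L (ι ⊕ F)) (β : F → U),
    (∀ v : ι ⊕ B → U, φ.Realize v ↔ χ.Realize (v ∘ Sum.map id (↑))) ∧ (∀ i, β i ∈ N) ∧
      LsEquiv L C (fun i : F => ((i : B) : U)) β ∧ χ.Realize (Sum.elim α β)}

variable {B : Set U}

/-- The extension is well defined: truth at representatives depends neither on the representatives
nor on how `φ` is written with its parameters displayed. Both sides are compared with one common
representative of all the parameters involved, by invariance of the type of `α` over `N`. -/
theorem realize_iff_of_representatives [Nonempty U] (hμ : ℵ₀ ≤ μ) (hrep : HasReps L C N D μ)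
    (hα : InvariantOver L C N α) {φ : PosFormula L (ι ⊕ B)} {F : Finset B}
    {χ : PosFormula L (ι ⊕ F)} {β : F → U}
    (hχ : ∀ v : ι ⊕ B → U, φ.Realize v ↔ χ.Realize (v ∘ Sum.map id (↑))) (hβN : ∀ i, β i ∈ N)
    (hβ : LsEquiv L C (fun i : F => ((i : B) : U)) β) {K : Type (max u v)} {b : K → B}
    {χ' : PosFormula L (ι ⊕ K)} (hχ' : ∀ v : ι ⊕ B → U, φ.Realize v ↔ χ'.Realize (v ∘ Sum.map id b))
    {β' : K → U} (hβN' : ∀ k, β' k ∈ N) (hβ' : LsEquiv L C (fun k => (b k : U)) β') :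
    χ.Realize (Sum.elim α β) ↔ χ'.Realize (Sum.elim α β') := by
  classical
  obtain ⟨E, θ, hθ⟩ := χ'.exists_finite_params (U := U)
  let G : Finset B := F ∪ E.image b
  obtain ⟨γ, hγN, hγ⟩ := hrep.exists_lsEquiv (K := G)
    ((lt_aleph0_of_finite G).le.trans hμ) fun i => ((i : B) : U)
  -- The common representative viewed as an assignment on all of `B`. Evaluating `φ` at it makes the
  -- two ways of writing `φ` agree; the value outside `G` plays no role.
  let V : B → U := fun x => if h : x ∈ G then γ ⟨x, h⟩ else Classical.arbitrary U
  have h₁ : χ.Realize (Sum.elim α β) ↔ χ.Realize (Sum.elim α fun i : F => V i) := by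
    have hF : ∀ i : F, (i : B) ∈ G := fun i => Finset.mem_union_left _ i.2
    have e : (fun i : F => V i) = γ ∘ fun i : F => ⟨i, hF i⟩ := by
      funext i
      simp [V, hF i]
    rw [e]
    exact hα.realize_iff hβN (fun _ => hγN _) (hβ.symm.trans (hγ.comp fun i : F => ⟨i, hF i⟩)) χ
  have h₂ : θ.Realize (Sum.elim α (β' ∘ fun i : E => (i : K))) ↔
      θ.Realize (Sum.elim α fun i : E => V (b i)) := by
    have hE : ∀ i : E, b i ∈ G := fun i =>
      Finset.mem_union_right _ (Finset.mem_image_of_mem _ i.2)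
    have e : (fun i : E => V (b i)) = γ ∘ fun i : E => ⟨b i, hE i⟩ := by
      funext i
      simp [V, hE i]
    rw [e]
    exact hα.realize_iff (fun _ => hβN' _) (fun _ => hγN _)
      ((hβ'.comp fun i : E => (i : K)).symm.trans (hγ.comp fun i : E => ⟨b i, hE i⟩)) θ
  have h₃ := (hχ (Sum.elim α V)).symm.trans (hχ' (Sum.elim α V))
  rw [hθ, Sum.elim_comp_map, Sum.elim_comp_map, Sum.elim_comp_map] at h₃
  rw [h₁, hθ, Sum.elim_comp_map]
  exact h₃.trans h₂.symm

theorem mem_extendType_iff [Nonempty U] (hμ : ℵ₀ ≤ μ) (hrep : HasReps L C N D μ)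
    (hα : InvariantOver L C N α) {φ : PosFormula L (ι ⊕ B)} {K : Type (max u v)} {b : K → B}
    {χ : PosFormula L (ι ⊕ K)} (hχ : ∀ v : ι ⊕ B → U, φ.Realize v ↔ χ.Realize (v ∘ Sum.map id b))
    {β : K → U} (hβN : ∀ k, β k ∈ N) (hβ : LsEquiv L C (fun k => (b k : U)) β) :
    φ.1 ∈ extendType L C N B α ↔ χ.Realize (Sum.elim α β) := by
  constructor
  · rintro ⟨-, F, χ', β', h₁, h₂, h₃, h₄⟩
    exact (realize_iff_of_representatives hμ hrep hα h₁ h₂ h₃ hχ hβN hβ).1 h₄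
  · intro h
    obtain ⟨F, χ', h₁⟩ := φ.exists_finite_params (U := U)
    obtain ⟨β', h₂, h₃⟩ := hrep.exists_lsEquiv (K := F) ((lt_aleph0_of_finite F).le.trans hμ)
      fun i => ((i : B) : U)
    exact ⟨φ.2, F, χ', β', h₁, h₂, h₃,
      (realize_iff_of_representatives hμ hrep hα h₁ h₂ h₃ hχ hβN hβ).2 h⟩

/-- Finitely many members of the extension are jointly satisfied by `α` over a representative γ, so
the corresponding existential formula holds of γ, hence of the true parameters, as these are Lascar
equivalent to γ. For maximality, a formula failing at its representative is refuted there by a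
positive formula, which belongs to the extension. -/
theorem isType_extendType {T : L.Theory} [Nonempty U] (hU : IsEC T U) (hμ : ℵ₀ ≤ μ)
    (hrep : HasReps L C N D μ) (hα : InvariantOver L C N α) :
    IsType B (extendType L C N B α) := by
  classical
  have hfin : ∀ F : Finset B, #F ≤ μ := fun F => (lt_aleph0_of_finite F).le.trans hμ
  refine ⟨⟨fun φ h => h.1, fun F hF => ?_⟩, fun q hq hle φ hφ => ?_⟩
  · have hF' : ∀ φ : F, φ.1 ∈ extendType L C N B α := fun φ => hF φ.2
    have hpos : ∀ φ : F, IsPositive φ.1 := fun φ => (hF' φ).1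
    choose E χ hχ using fun φ : F =>
      PosFormula.exists_finite_params (U := U) (⟨φ.1, hpos φ⟩ : PosFormula L (ι ⊕ B))
    let G : Finset B := Finset.univ.biUnion E
    have hEG : ∀ φ, E φ ⊆ G := fun φ => Finset.subset_biUnion_of_mem E (Finset.mem_univ φ)
    obtain ⟨γ, hγN, hγ⟩ := hrep.exists_lsEquiv (hfin G) fun i => ((i : B) : U)
    let χ' : F → PosFormula L (ι ⊕ G) := fun φ =>
      (χ φ).relabel (Sum.map id fun i => ⟨i, hEG φ i.2⟩)
    have hχ' : ∀ φ (v : ι ⊕ B → U), φ.1.Realize v ↔ (χ' φ).Realize (v ∘ Sum.map id (↑)) := by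
      intro φ v
      rw [PosFormula.realize_relabel, Function.comp_assoc, Sum.map_comp_map]
      exact hχ φ v
    obtain ⟨η, hη⟩ := PosFormula.exists_forall_mem (Finset.univ.image χ')
    obtain ⟨θ, hθ⟩ := η.exists_exists_sumElim
    have h₁ : θ.Realize γ := by
      refine (hθ U γ).2 ⟨α, (hη U _).2 fun ψ hψ => ?_⟩
      obtain ⟨φ, -, rfl⟩ := Finset.mem_image.1 hψ
      exact (mem_extendType_iff (φ := ⟨φ.1, hpos φ⟩) hμ hrep hα (hχ' φ) hγN hγ).1 (hF' φ)
    obtain ⟨a, ha⟩ := (hθ U _).1 ((hγ.realize_iff θ).2 h₁)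
    refine ⟨a, fun φ hφ => (hχ' ⟨φ, hφ⟩ _).2 ?_⟩
    rw [Sum.elim_comp_map]
    exact (hη U _).1 ha _ (Finset.mem_image_of_mem _ (Finset.mem_univ _))
  · have hpos := hq.1 φ hφ
    obtain ⟨F, χ, hχ⟩ := PosFormula.exists_finite_params (U := U) (⟨φ, hpos⟩ : PosFormula L (ι ⊕ B))
    obtain ⟨γ, hγN, hγ⟩ := hrep.exists_lsEquiv (hfin F) fun i => ((i : B) : U)
    refine (mem_extendType_iff (φ := ⟨φ, hpos⟩) hμ hrep hα hχ hγN hγ).2 ?_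
    by_contra hn
    obtain ⟨ψ, hψ, hψχ⟩ := hU.exists_contradicting χ _ hn
    have hψq : (ψ.relabel (Sum.map id (↑)) : PosFormula L (ι ⊕ B)).1 ∈ q :=
      hle ((mem_extendType_iff hμ hrep hα (fun v => PosFormula.realize_relabel ψ _ v) hγN hγ).2 hψ)
    obtain ⟨a, ha⟩ := hq.2 {φ, (ψ.relabel (Sum.map id (↑)) : PosFormula L (ι ⊕ B)).1} (by
      intro θ hθ
      rcases Finset.mem_insert.1 (Finset.mem_coe.1 hθ) with rfl | hθ
      · exact hφ
      · rw [Finset.mem_singleton.1 hθ]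
        exact hψq)
    refine hψχ _ ((hχ _).1 (ha φ (Finset.mem_insert_self _ _))) ?_
    exact (PosFormula.realize_relabel ψ _ _).1
      (ha _ (Finset.mem_insert_of_mem (Finset.mem_singleton_self _)))

theorem restrict_extendType [Nonempty U] (hμ : ℵ₀ ≤ μ) (hrep : HasReps L C N D μ)
    (hα : InvariantOver L C N α) (hNB : N ⊆ B) {p : Set (L.Formula (ι ⊕ N))} (hp : IsType N p)
    (hαp : Realises α p) : restrict hNB (extendType L C N B α) = p := by
  have key : ∀ φ : PosFormula L (ι ⊕ N),
      (φ.relabel (Sum.map id (Set.inclusion hNB))).1 ∈ extendType L C N B α ↔ φ.1 ∈ p := fun φ =>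
    (mem_extendType_iff (φ := φ.relabel (Sum.map id (Set.inclusion hNB))) (b := Set.inclusion hNB)
      (β := ((↑) : N → U)) hμ hrep hα (fun v => PosFormula.realize_relabel φ _ v)
      (fun k : N => k.2) .refl).trans (hp.mem_iff hαp φ).symm
  ext φ
  exact ⟨fun h => (key ⟨φ, h.1⟩).1 h.2, fun h => ⟨hp.1.1 φ h, (key ⟨φ, hp.1.1 φ h⟩).2 h⟩⟩

theorem Realises.of_restrict {hNB : N ⊆ B} {q : Set (L.Formula (ι ⊕ B))}
    {p : Set (L.Formula (ι ⊕ N))} (h : restrict hNB q = p) {α : ι → U} (hα : Realises α q) :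
    Realises α p := by
  intro φ hφ
  rw [← h] at hφ
  have := (PosFormula.realize_relabel ⟨φ, hφ.1⟩ (Sum.map id (Set.inclusion hNB)) _).1 (hα _ hφ.2)
  rwa [Sum.elim_comp_map] at this

theorem IsType.realize_iff_realize {p : Set (L.Formula (ι ⊕ N))} (hp : IsType N p) {α α' : ι → U}
    (hα : Realises α p) (hα' : Realises α' p) {K : Type (max u v)} {β : K → U}
    (hβ : ∀ k, β k ∈ N) (φ : PosFormula L (ι ⊕ K)) :
    φ.Realize (Sum.elim α β) ↔ φ.Realize (Sum.elim α' β) := by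
  have := (hp.mem_iff hα (φ.relabel (Sum.map id fun k => ⟨β k, hβ k⟩))).symm.trans
    (hp.mem_iff hα' _)
  rwa [PosFormula.realize_relabel, PosFormula.realize_relabel, Sum.elim_comp_map,
    Sum.elim_comp_map] at this

/-- Representatives lie in `N ⊆ B`, so invariance over `B` lets `α'` exchange parameters for
representatives. Over `N`, both `α'` and `α` realise `p`. -/
theorem eq_extendType [Nonempty U] {T : L.Theory} (hU : IsEC T U) (hμ : ℵ₀ ≤ μ)
    (hrep : HasReps L C N D μ) (hα : InvariantOver L C N α) (hNB : N ⊆ B)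
    {p : Set (L.Formula (ι ⊕ N))} (hp : IsType N p) (hαp : Realises α p)
    {q : Set (L.Formula (ι ⊕ B))} (hq : IsType B q) (hqp : restrict hNB q = p)
    {α' : ι → U} (hα' : Realises α' q) (hinv : InvariantOver L C B α') :
    q = extendType L C N B α := by
  refine hq.ext_of_realises (isType_extendType hU hμ hrep hα) fun φ => ?_
  obtain ⟨F, χ, hχ⟩ := φ.exists_finite_params (U := U)
  obtain ⟨γ, hγN, hγ⟩ := hrep.exists_lsEquiv (K := F) ((lt_aleph0_of_finite F).le.trans hμ)
    fun i => ((i : B) : U)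
  rw [hq.mem_iff hα', mem_extendType_iff hμ hrep hα hχ hγN hγ, hχ, Sum.elim_comp_map]
  refine (hinv.realize_iff (fun i : F => (i : B).2) (fun i => hNB (hγN i)) hγ χ).trans ?_
  exact hp.realize_iff_realize (hα'.of_restrict hqp) hαp hγN χ

end Extension

/-! ### Invariance of the extension -/

section Invariance

open Cardinal Presentation

variable {L : FirstOrder.Language.{u, v}} {U : Type (max u v)} [L.Structure U]

variable (L) in
/-- Small tuples with the same type over `D` are Lascar equivalent over `C`. -/
def DeterminesLs (C D : Set U) (κ : Cardinal.{max u v}) : Prop :=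
  ∀ (J : Type (max u v)), #J < κ → ∀ a a' : J → U,
    (∀ φ : PosFormula L (J ⊕ D), φ.Realize (append a D) → φ.Realize (append a' D)) →
      LsEquiv L C a a'

variable {T : L.Theory} {κ μ : Cardinal.{max u v}} {C N D B : Set U}

theorem mk_sum_lt {J K : Type w} {κ : Cardinal.{w}} (hκ : ℵ₀ < κ) (hJ : #J < κ) (hK : #K < κ) :
    #(J ⊕ K) < κ := by
  rw [mk_sum, lift_id, lift_id]
  exact add_lt_of_lt hκ.le hJ hK

/-- Realise in `N` the type of `b` over `D`. Appending `D` adds no information to a type over `D`,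
so `bD` and `βD` again have the same type over `D`. -/
theorem DeterminesLs.hasReps (hdet : DeterminesLs L C D κ) (hμ : ℵ₀ ≤ μ) (hμκ : μ < κ)
    (hDN : D ⊆ N) (hD : #D ≤ μ) (hN : SatIn L N (Order.succ μ)) : HasReps L C N D μ := by
  intro K hK b
  obtain ⟨β, hβN, hβ⟩ := hN K (Order.lt_succ_iff.2 hK) D (↑) (fun d => hDN d.2)
    (Order.lt_succ_iff.2 (mk_range_le.trans hD)) {φ | φ.Realize (append b D)}
    fun F hF => ⟨b, fun φ hφ => hF hφ⟩
  refine ⟨β, hβN, hdet (K ⊕ D)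
    (mk_sum_lt (hμ.trans_lt hμκ) (hK.trans_lt hμκ) (hD.trans_lt hμκ)) _ _ fun φ hφ => ?_⟩
  have hr : ∀ b : K → U, append (append b D) D = append b D ∘ Sum.elim id Sum.inr := fun b => by
    funext z
    rcases z with (k | d) | d <;> rfl
  rw [hr, ← PosFormula.realize_relabel] at hφ ⊢
  exact hβ _ hφ

variable {ι : Type (max u v)} {α α' : ι → U}

theorem Realises.realize_iff_of_lsEquiv [Nonempty U] (hU : IsEC T U) (hμ : ℵ₀ ≤ μ)
    (hrep : HasReps L C N D μ) (hα : InvariantOver L C N α) {p : Set (L.Formula (ι ⊕ N))}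
    (hp : IsType N p) (hαp : Realises α p) (hα'p : Realises α' p)
    (hα' : Realises α' (extendType L C N B α)) {K : Type (max u v)} {b : K → B} {β : K → U}
    (hβN : ∀ k, β k ∈ N) (hβ : LsEquiv L C (fun k => (b k : U)) β) (ψ : PosFormula L (ι ⊕ K)) :
    ψ.Realize (Sum.elim α' fun k => (b k : U)) ↔ ψ.Realize (Sum.elim α' β) := by
  have h₁ := mem_extendType_iff (φ := ψ.relabel (Sum.map id b)) hμ hrep hα
    (fun v => PosFormula.realize_relabel ψ _ v) hβN hβ
  rw [(isType_extendType hU hμ hrep hα).mem_iff hα', PosFormula.realize_relabel,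
    Sum.elim_comp_map] at h₁
  exact h₁.trans (hp.realize_iff_realize hαp hα'p hβN ψ)

/-- Since `bD` and `βD` are Lascar equivalent, `α'b` and `α'β` have the same type over `D` and so
are Lascar equivalent. This is why representatives must remain equivalent after appending `D`. The
pair `b, b'` is thereby replaced by a pair in `N`. -/
theorem InvariantOver.of_le [Nonempty U] (hU : IsEC T U) (hμ : ℵ₀ ≤ μ) (hμκ : μ < κ)
    (hdet : DeterminesLs L C D κ) (hDN : D ⊆ N)
    (hrep : HasReps L C N D μ) (hα : InvariantOver L C N α) {p : Set (L.Formula (ι ⊕ N))}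
    (hp : IsType N p) (hαp : Realises α p) (hα'p : Realises α' p) (hNB : N ⊆ B)
    (hα'N : InvariantOver L C N α') (hι : #ι < κ) (hα' : Realises α' (extendType L C N B α))
    {K : Type (max u v)} (hK : #K ≤ μ) {b b' : K → U} (hb : ∀ k, b k ∈ B) (hb' : ∀ k, b' k ∈ B)
    (hbb : LsEquiv L C b b') : LsEquiv L C (Sum.elim α' b) (Sum.elim α' b') := by
  have hκ := hμ.trans_lt hμκ
  have key : ∀ b β : K → U, (∀ k, b k ∈ B) → (∀ k, β k ∈ N) →
      LsEquiv L C (append b D) (append β D) → LsEquiv L C (Sum.elim α' b) (Sum.elim α' β) := by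
    intro b β hb hβ h
    refine hdet _ (mk_sum_lt hκ hι (hK.trans_lt hμκ)) _ _ fun φ hφ => ?_
    let b₀ : K ⊕ D → B := Sum.elim (fun k => ⟨b k, hb k⟩) fun d => ⟨d, hNB (hDN d.2)⟩
    have e₀ : (fun z => (b₀ z : U)) = append b D := by
      funext z
      rcases z with k | d <;> rfl
    have hr : ∀ b : K → U, append (Sum.elim α' b) D =
        Sum.elim α' (append b D) ∘ Equiv.sumAssoc ι K D := fun b => by
      funext z
      rcases z with (i | k) | d <;> rfl
    rw [hr, ← PosFormula.realize_relabel] at hφ ⊢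
    refine (Realises.realize_iff_of_lsEquiv (b := b₀) hU hμ hrep hα hp hαp hα'p hα' ?_ ?_ _).1 ?_
    · rintro (k | d)
      · exact hβ k
      · exact hDN d.2
    · rwa [e₀]
    · rwa [e₀]
  obtain ⟨β, hβN, hβ⟩ := hrep (K ⊕ K) (by
    rw [mk_sum]
    exact add_le_of_le hμ (by simpa using hK) (by simpa using hK)) (Sum.elim b b')
  have h₁ : LsEquiv L C (append b D) (append (β ∘ Sum.inl) D) := by
    convert hβ.comp (Sum.map Sum.inl id : K ⊕ D → (K ⊕ K) ⊕ D) using 1 <;>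
      (funext z; rcases z with k | d <;> rfl)
  have h₂ : LsEquiv L C (append b' D) (append (β ∘ Sum.inr) D) := by
    convert hβ.comp (Sum.map Sum.inr id : K ⊕ D → (K ⊕ K) ⊕ D) using 1 <;>
      (funext z; rcases z with k | d <;> rfl)
  have h₃ : LsEquiv L C (β ∘ Sum.inl) (β ∘ Sum.inr) :=
    ((h₁.comp Sum.inl).symm.trans hbb).trans (h₂.comp Sum.inl)
  exact ((key _ _ hb (fun _ => hβN _) h₁).trans
    (hα'N K _ _ (fun _ => hβN _) (fun _ => hβN _) h₃)).trans
      (key _ _ hb' (fun _ => hβN _) h₂).symm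

/-- Lascar equivalence of small tuples reduces to countable subtuples. -/
theorem IsThickMonster.lsEquiv_of_countable [Nonempty U]
    {Θ : ∀ n : ℕ, Set (PosFormula L (ℕ × Fin n))} (h : IsThickMonster T U κ Θ) (hC : #C < κ)
    {J : Type (max u v)} (hJ : #J < κ) {a a' : J → U}
    (H : ∀ S : Set J, S.Countable → LsEquiv L C (fun j : S => a j) (fun j : S => a' j)) :
    LsEquiv L C a a' := by
  by_contra hn
  rw [lsEquiv_iff_exists_chain h.defines, not_exists] at hn
  -- For each n, a finite subtuple on which no chain of length n exists. The union of these
  -- subtuples is countable and has no chain of any length, although by hypothesis it is Lascar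
  -- equivalent to its counterpart.
  have hfin : ∀ n, ∃ (m : ℕ) (e : Fin m → J ⊕ C), ¬ (chain Θ n).Rel (e ⁻¹' params J C)
      (append a C ∘ e) (append a' C ∘ e) := by
    intro n
    by_contra! hall
    exact hn n (rel_of_finite h.ec h.aleph0_lt h.sat _ (mk_sum_lt h.aleph0_lt hJ hC) _ _ _ hall)
  choose m e he using hfin
  let S : Set J := ⋃ n, ⋃ l, {j | e n l = Sum.inl j}
  have hS : S.Countable := Set.countable_iUnion fun n => Set.countable_iUnion fun l =>
    Set.Subsingleton.countable fun j hj j' hj' => Sum.inl_injective (hj.symm.trans hj')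
  obtain ⟨n, hrel⟩ := (lsEquiv_iff_exists_chain h.defines).1 (H S hS)
  have hfac : ∀ l, ∃ z : S ⊕ C, Sum.map (↑) id z = e n l := by
    intro l
    rcases hl : e n l with j | c
    · exact ⟨Sum.inl ⟨j, Set.mem_iUnion.2 ⟨n, Set.mem_iUnion.2 ⟨l, hl⟩⟩⟩, rfl⟩
    · exact ⟨Sum.inr c, rfl⟩
  choose f hf using hfac
  have ha : ∀ a : J → U, append (fun j : S => a j) C ∘ f = append a C ∘ e n := by
    intro a
    funext l
    rw [Function.comp_apply, Function.comp_apply, ← hf l]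
    rcases f l with j | c <;> rfl
  have hp : f ⁻¹' params S C = e n ⁻¹' params J C := by
    ext l
    rw [Set.mem_preimage, Set.mem_preimage, ← hf l]
    rcases f l with j | c <;> simp [params]
  refine he n ?_
  rw [← ha, ← ha, ← hp]
  exact Rel.comp hrel f

theorem IsThickMonster.invariantOver [Nonempty U] {Θ : ∀ n : ℕ, Set (PosFormula L (ℕ × Fin n))}
    (h : IsThickMonster T U κ Θ) (hC : #C < κ) (hμ : ℵ₀ ≤ μ) (hμκ : μ < κ)
    (hdet : DeterminesLs L C D κ) (hDN : D ⊆ N)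
    (hrep : HasReps L C N D μ) (hα : InvariantOver L C N α) {p : Set (L.Formula (ι ⊕ N))}
    (hp : IsType N p) (hαp : Realises α p) (hα'p : Realises α' p) (hNB : N ⊆ B) (hB : #B < κ)
    (hα'N : InvariantOver L C N α') (hι : #ι < κ) (hα' : Realises α' (extendType L C N B α)) :
    InvariantOver L C B α' := by
  intro J b b' hb hb' hbb
  -- The index type `J` may be large and its tuples repetitive. Only the pairs (b_j, b'_j) matter,
  -- and there are fewer than κ of them because `B` is small.
  let R : Set (B × B) := Set.range fun j => (⟨b j, hb j⟩, ⟨b' j, hb' j⟩)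
  have hR : #R < κ := by
    refine (mk_set_le _).trans_lt ?_
    rw [mk_prod]
    exact mul_lt_of_lt h.aleph0_lt.le (by simpa using hB) (by simpa using hB)
  choose s hs using fun r : R => r.2
  let f : J → R := fun j => ⟨_, j, rfl⟩
  have hf : ∀ j, b (s (f j)) = b j ∧ b' (s (f j)) = b' j := fun j =>
    ⟨congrArg (fun z : B × B => (z.1 : U)) (hs (f j)), congrArg (fun z : B × B => (z.2 : U)) (hs (f j))⟩
  have key : LsEquiv L C (Sum.elim α' (b ∘ s)) (Sum.elim α' (b' ∘ s)) := by
    refine h.lsEquiv_of_countable hC (mk_sum_lt h.aleph0_lt hι hR) fun S hS => ?_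
    let K : Set R := Sum.inr ⁻¹' S
    have hK : #K ≤ μ :=
      (mk_le_aleph0_iff.2 (hS.preimage Sum.inr_injective).to_subtype).trans hμ
    have := InvariantOver.of_le h.ec hμ hμκ hdet hDN hrep hα hp hαp hα'p hNB hα'N hι hα' hK
      (b := fun k => b (s k)) (b' := fun k => b' (s k)) (fun _ => hb _) (fun _ => hb' _)
      (hbb.comp fun k : K => s k)
    let g : S → ι ⊕ K := fun z => match z with
      | ⟨Sum.inl i, _⟩ => Sum.inl i
      | ⟨Sum.inr r, hr⟩ => Sum.inr ⟨r, hr⟩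
    convert this.comp g using 1 <;> (funext z; rcases z with ⟨i | r, hz⟩ <;> rfl)
  convert key.comp (Sum.map id f) using 1
  · funext z
    rcases z with i | j
    · rfl
    · exact (hf j).1.symm
  · funext z
    rcases z with i | j
    · rfl
    · exact (hf j).2.symm

theorem existsUnique_extension [Nonempty U] {Θ : ∀ n : ℕ, Set (PosFormula L (ℕ × Fin n))}
    (h : IsThickMonster T U κ Θ) (hC : #C < κ) (hCN : C ⊆ N) (hNB : N ⊆ B)
    (hμ : 2 ^ (#C + max ℵ₀ L.card) ≤ μ) (hμκ : μ < κ) (hN : SatIn L N (Order.succ μ))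
    (hB : #B < κ) (hsat : IsSaturated L U κ) (hι : #ι < κ) {p : Set (L.Formula (ι ⊕ N))}
    (hp : IsType N p) (hinv : IsLsInvariant C p) :
    ∃! q : Set (L.Formula (ι ⊕ B)), IsType B q ∧ restrict hNB q = p ∧ IsLsInvariant C q := by
  have hμ₀ : ℵ₀ ≤ μ :=
    ((le_max_left _ _).trans (self_le_add_left _ _)).trans ((cantor _).le.trans hμ)
  obtain ⟨D, hDN, hD, hdet⟩ := h.exists_representatives hCN hC hμ hN
  have hrep : HasReps L C N D μ := DeterminesLs.hasReps hdet hμ₀ hμκ hDN hD hN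
  obtain ⟨α, hα⟩ := hsat N ((mk_le_mk_of_subset hNB).trans_lt hB) ι hι p hp.1
  have hαN : InvariantOver L C N α := hinv α hα
  refine ⟨extendType L C N B α, ⟨isType_extendType h.ec hμ₀ hrep hαN,
    restrict_extendType hμ₀ hrep hαN hNB hp hα, fun α' hα' => ?_⟩, ?_⟩
  · have hα'p : Realises α' p := hα'.of_restrict (restrict_extendType hμ₀ hrep hαN hNB hp hα)
    exact h.invariantOver hC hμ₀ hμκ hdet hDN hrep hαN hp hα hα'p hNB hB (hinv α' hα'p) hι hα'
  · rintro q ⟨hq, hqp, hqinv⟩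
    obtain ⟨α', hα'⟩ := hsat B hB ι hι q hq.1
    exact eq_extendType h.ec hμ₀ hrep hαN hNB hp hα hq hqp hα' (hqinv α' hα')

theorem existsUnique_extension_of_isEmpty [IsEmpty U] (hNB : N ⊆ B)
    {p : Set (L.Formula (ι ⊕ N))} (hp : IsType N p) :
    ∃! q : Set (L.Formula (ι ⊕ B)), IsType B q ∧ restrict hNB q = p ∧ IsLsInvariant C q := by
  -- In an empty structure there is at most one assignment of the variables, and satisfiability of
  -- `p` provides it. Every type then consists of the formulas true at this assignment.
  obtain ⟨α, -⟩ := hp.1.2 ∅ (by simp)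
  have hα : ∀ {B : Set U} {p : Set (L.Formula (ι ⊕ B))}, IsType B p → Realises α p := by
    intro B p hp φ hφ
    obtain ⟨a, ha⟩ := hp.1.2 {φ} (by simpa using hφ)
    rw [Subsingleton.elim α a]
    exact ha φ (by simp)
  have htype : IsType B {φ : L.Formula (ι ⊕ B) | IsPositive φ ∧ Holds φ α} := by
    refine ⟨⟨fun φ hφ => hφ.1, fun F hF => ⟨α, fun φ hφ => (hF hφ).2⟩⟩, fun q hq _ φ hφ => ?_⟩
    obtain ⟨a, ha⟩ := hq.2 {φ} (by simpa using hφ)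
    rw [Subsingleton.elim a α] at ha
    exact ⟨hq.1 φ hφ, ha φ (by simp)⟩
  refine ⟨_, ⟨htype, ?_, fun α' _ J b b' _ _ _ => ?_⟩, fun q hq => ?_⟩
  · ext φ
    have key : ∀ φ : PosFormula L (ι ⊕ N),
        (φ.relabel (Sum.map id (Set.inclusion hNB))).Realize (append α B) ↔ φ.1 ∈ p := by
      intro φ
      rw [hp.mem_iff (hα hp), PosFormula.realize_relabel, Sum.elim_comp_map]
      rfl
    exact ⟨fun h => (key ⟨φ, h.1⟩).1 h.2.2, fun h =>
      ⟨hp.1.1 φ h, (PosFormula.relabel ⟨φ, hp.1.1 φ h⟩ _).2, (key ⟨φ, hp.1.1 φ h⟩).2 h⟩⟩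
  · rw [Subsingleton.elim b b']
    exact .refl
  · exact hq.1.ext_of_realises htype fun φ =>
      (hq.1.mem_iff (hα hq.1) φ).trans (htype.mem_iff (hα htype) φ).symm

end Invariance

end PosLogic

end

/-- `U` is the bigger monster (in which global types are realised), `𝔐` the monster, `κ` the degree
of saturation of the monster ("small" means of cardinality less than `κ`). -/
theorem mainTheorem10 {L : FirstOrder.Language.{u, v}} (T : L.Theory)
    (hT : PosLogic.IsHInductive T) (hthick : PosLogic.IsThick T)
    (U : Type (max u v)) [L.Structure U] (𝔐 N : L.Substructure U)
    (κ κ' : Cardinal.{max u v})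
    (hUec : PosLogic.IsEC T U) (hUsat : PosLogic.IsSaturated L U κ')
    (hκκ' : κ ≤ κ') (h𝔐U : Cardinal.mk 𝔐 < κ')
    (h𝔐ec : PosLogic.IsEC T 𝔐) (h𝔐sat : PosLogic.IsSaturated L 𝔐 κ)
    (C : Set U) (hCN : C ⊆ (N : Set U)) (hN𝔐 : (N : Set U) ⊆ (𝔐 : Set U))
    (hκ : (2 : Cardinal.{max u v}) ^ (Cardinal.mk C + PosLogic.lambdaT L) < κ)
    (hNsmall : Cardinal.mk N < κ)
    (hNec : PosLogic.IsEC T N)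
    (hNsat : PosLogic.IsSaturated L N
      (Order.succ ((2 : Cardinal.{max u v}) ^ (Cardinal.mk C + PosLogic.lambdaT L))))
    (ι : Type (max u v)) (hι : Cardinal.mk ι < κ)
    (p : Set (L.Formula (ι ⊕ (N : Set U)))) (hp : PosLogic.IsType (N : Set U) p)
    (hpinv : PosLogic.IsLsInvariant C p) :
    ∃! q : Set (L.Formula (ι ⊕ (𝔐 : Set U))),
      PosLogic.IsType (𝔐 : Set U) q ∧ PosLogic.restrict hN𝔐 q = p ∧
        PosLogic.IsLsInvariant C q := by
  classical
  rcases isEmpty_or_nonempty U with hU | hU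
  · exact PosLogic.existsUnique_extension_of_isEmpty hN𝔐 hp
  obtain ⟨Θ, hΘ⟩ := PosLogic.IsThick.exists_definesIndisc hthick hUec
  have hlam : ∀ k, PosLogic.iteratedExp (max ℵ₀ L.card) k < PosLogic.lambdaT L :=
    PosLogic.iteratedExp_lt_lambdaT L
  have hcant := Cardinal.cantor (#C + PosLogic.lambdaT L)
  have hlt : #C + PosLogic.lambdaT L < κ' := (hcant.trans hκ).trans_le hκκ'
  -- The general statement is applied to the saturation cardinal of the big monster, for which the
  -- whole of the monster is a small parameter set. The role of λ_T is to exceed |T| and all its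
  -- finite iterated exponentials.
  refine PosLogic.existsUnique_extension (T := T) (κ := κ') (Θ := Θ)
    ⟨hUec, fun k => ((hlam k).trans_le (self_le_add_left _ _)).trans hlt, hUsat.satIn_univ, hΘ⟩
    ((self_le_add_right _ _).trans_lt hlt) hCN hN𝔐 ?_ (hκ.trans_le hκκ')
    (PosLogic.IsSaturated.satIn_of_isEC hUec.1 hNec hNsat) h𝔐U hUsat (hι.trans_le hκκ') hp hpinv
  exact Cardinal.power_le_power_left two_ne_zero (add_le_add le_rfl (hlam 0).le)
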